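/- Let $k\ge 3$ be an integer, $\lambda_k=2\cos(\pi/k)$, $p\in[0,1]$, $q=1-p$ and $p_c=(2-\lambda_k)/4$. Let $(g_n)_{n\ge1}$ be a $(p,\lambda_k)$-random Fibonacci sequence: $g_1=a>0$ and $g_2=b>0$ are constants, and for every $n\ge1$, $g_{n+2}=|\lambda_k g_{n+1}+g_n|$ with probability $p$ and $g_{n+2}=|\lambda_k g_{n+1}-g_n|$ with probability $q$, the choices of sign for different $n$ being independent. Let $m_n=\mathbb E(g_n)$ (every $g_n$ is integrable). (i) If $p>p_c$, then $m_n>0$ for all $n\ge 1$, the polynomial $$P_k(X)=X^{2k}-\lambda_kX^{2k-1}-(2p-1)X^{2k-2}-\lambda_k\,p\,q^{k-1}X^{k-1}-p^2q^{2k-2}$$ has exactly one positive real root $\alpha_k(p)$, and $$\frac{m_{n+1}}{m_n}\ \longrightarrow\ \alpha_k(p)\left(1+\frac{p\,q^{k-1}}{\alpha_k(p)^k}\right)>1\qquad(n\to\infty).$$ (ii) If $p=p_c$, then $(m_n)$ grows at most linearly: there is a constant $K$ with $m_n\le Kn$ for all $n\ge1$. (iii) If $p<p_c$, then $(m_n)_{n\ge1}$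 is bounded. -/

import Mathlib

open MeasureTheory ProbabilityTheory Filter Topology Polynomial

/-- `ε` is a sequence of independent tosses of a coin showing `true` (the sign `+`) with
probability `p`, and hence `false` (the sign `-`) with probability `1 - p`. -/
structure IsCoinTossing {Ω : Type*} [MeasurableSpace Ω] (μ : Measure Ω) (p : ℝ)
    (ε : ℕ → Ω → Bool) : Prop where
  measurable : ∀ n, Measurable (ε n)
  indep : iIndepFun ε μ
  prob_true : ∀ n, μ {ω | ε n ω = true} = ENNReal.ofReal p

/-- `g 1, g 2, g 3, …` is a `(p, lam)`-random Fibonacci sequence: `g 1` and `g 2` are positive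
constants and `g (n + 2) = |lam * g (n + 1) ± g n|` for all `n ≥ 1`, the signs being given by
independent tosses of a coin showing `+` with probability `p`. (The term `g 0` is not used.) -/
structure IsRandomFibonacci {Ω : Type*} [MeasurableSpace Ω] (μ : Measure Ω) (p lam : ℝ)
    (g : ℕ → Ω → ℝ) : Prop where
  init_one : ∃ a : ℝ, 0 < a ∧ ∀ ω, g 1 ω = a
  init_two : ∃ b : ℝ, 0 < b ∧ ∀ ω, g 2 ω = b
  step : ∃ ε : ℕ → Ω → Bool, IsCoinTossing μ p ε ∧
    ∀ n, 1 ≤ n → ∀ ω,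
      g (n + 2) ω =
        if ε n ω = true then |lam * g (n + 1) ω + g n ω| else |lam * g (n + 1) ω - g n ω|

/-- `λ_k = 2 cos (π / k)`. -/
noncomputable def lambdaK (k : ℕ) : ℝ := 2 * Real.cos (Real.pi / k)

/-- The critical value `p_c = (2 - λ_k) / 4`. -/
noncomputable def criticalP (k : ℕ) : ℝ := (2 - lambdaK k) / 4

/-- The polynomial `P_k`, with `q = 1 - p`. -/
noncomputable def polyP (k : ℕ) (p : ℝ) : ℝ[X] :=
  X ^ (2 * k) - C (lambdaK k) * X ^ (2 * k - 1) - C (2 * p - 1) * X ^ (2 * k - 2)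
    - C (lambdaK k * p * (1 - p) ^ (k - 1)) * X ^ (k - 1)
    - C (p ^ 2 * (1 - p) ^ (2 * k - 2))

/-!
The operator of the sign `-` is, up to the absolute value, a rotation by `π / k`. Hence a sign `+`
followed by `k - 1` signs `-` acts trivially on pairs of consecutive terms, with no absolute value
acting before the last of these signs (`iterate_stepMinus_pred_stepPlus`), and such blocks may be
cancelled. Let `D(t)` be the generating function of the probabilities that everything cancels; it
solves `D = 1 + p q ^ (k - 1) t ^ k D ^ k` (`treeSeries`). In the variables `x = t D` and `w = q x`,
the generating function of the means for the starting pair `v` is `∑ i, w ^ i F(T ^ i v)`, where `T`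
is the move for the sign `-`, `i` counts the uncancelled signs `-` at the start, and `F` is linear
in `v` (`meanFun_eq_coeff`). Solving the first step equation of `F` (`keptSeries_eq`) leads to a
symmetric `2 × 2` matrix whose `1 - det (1 - M)` is a polynomial `K(x)` with nonnegative
coefficients (`kernelPoly`; the nonnegativity rests on the identity `sinePoly_one_sq_sub`), and `F`
is `1 / (1 - K(x(t)))` times a series converging where `D` does. Moreover `1 - K(x)` is, up to a
positive factor, the reciprocal polynomial of `P_k` (`charPoly_mul_one_sub_kernelPoly`). As `K` is
increasing, `P_k` has exactly one positive root `α`, and `K(1 / α) = 1`.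

At `t = 1` one has `x ≤ 1 / q`, and `K(1 / q) - 1` has the sign of `p - p_c` (`deltaFun_inv`). If
`p ≤ p_c`, then `K(x(1)) ≤ 1`, the coefficients of `1 / (1 - K)` are at most `1`, and at most
`n + 1` bounded terms contribute to the `n`-th mean (`meanFun_linear_bound`). If `p < p_c`, these
coefficients are summable, while those of `1 / (1 - w)` are at most `1` (`meanFun_bounded`). If
`p > p_c`, then `t = x / (1 + p q ^ (k - 1) x ^ k)` at `x = 1 / α` is less than `1` and lies inside
the disc of convergence of `D` (`exists_deltaFun_neg`), and the renewal theorem (`renewal_tendsto`)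
together with dominated convergence over `i` shows that the `n`-th mean times `t ^ n` has a positive
limit (`meanFun_tendsto`), which gives the limit `1 / t` of the ratios.
-/

open Finset.HasAntidiagonal (antidiagonal)

/-! ### The renewal theorem -/

section Renewal

variable {f u : ℕ → ℝ}

/-- The coefficients of `1 / (1 - f)` lie in `[0, 1]` as soon as those of `f` form a
subprobability with no mass at `0`. -/
lemma renewal_mem_Icc (hf : ∀ n, 0 ≤ f n) (h0 : f 0 = 0)
    (hs : ∀ n, ∑ i ∈ Finset.range n, f i ≤ 1)
    (hu : ∀ n, u n = (if n = 0 then 1 else 0) + ∑ ij ∈ antidiagonal n, f ij.1 * u ij.2)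
    (n : ℕ) : u n ∈ Set.Icc (0 : ℝ) 1 := by
  induction n using Nat.strong_induction_on with
  | _ n ih =>
    rcases Nat.eq_zero_or_pos n with rfl | hn
    · have := hu 0
      simp [h0] at this
      simp [this]
    · have key : ∀ ij ∈ antidiagonal n,
          0 ≤ f ij.1 * u ij.2 ∧ f ij.1 * u ij.2 ≤ f ij.1 := by
        intro ij hij
        rw [Finset.HasAntidiagonal.mem_antidiagonal] at hij
        rcases Nat.eq_zero_or_pos ij.1 with h | h
        · simp [h, h0]
        · have := ih ij.2 (by omega)
          exact ⟨mul_nonneg (hf _) this.1, mul_le_of_le_one_right (hf _) this.2⟩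
      rw [hu n, if_neg hn.ne', zero_add]
      refine ⟨Finset.sum_nonneg fun ij h => (key ij h).1, ?_⟩
      refine (Finset.sum_le_sum fun ij h => (key ij h).2).trans ?_
      rw [Finset.Nat.sum_antidiagonal_eq_sum_range_succ (fun i _ => f i)]
      exact hs _

/-- The tails `∑ i > n, f i` of a probability on `ℕ` with finite mean form a summable sequence. -/
lemma summable_tail (hf : ∀ n, 0 ≤ f n) (hs : HasSum f 1) (hm : Summable fun n : ℕ => n * f n) :
    Summable fun n => 1 - ∑ i ∈ Finset.range (n + 1), f i := by
  have hτ0 : ∀ n, 0 ≤ 1 - ∑ i ∈ Finset.range (n + 1), f i := fun n =>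
    sub_nonneg.2 (sum_le_hasSum _ (fun i _ => hf i) hs)
  refine summable_of_sum_range_le (c := ∑' n : ℕ, n * f n) hτ0 fun n => ?_
  have h1 : ∑ j ∈ Finset.range n, (1 - ∑ i ∈ Finset.range (j + 1), f i)
      = n * (1 - ∑ i ∈ Finset.range (n + 1), f i) + ∑ i ∈ Finset.range (n + 1), i * f i := by
    induction n with
    | zero => simp
    | succ n ih =>
      rw [Finset.sum_range_succ, ih, Finset.sum_range_succ (fun i => f i) (n + 1),
        Finset.sum_range_succ (fun i : ℕ => (i : ℝ) * f i) (n + 1)]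
      push_cast
      ring
  have h2 := hm.sum_add_tsum_nat_add (n + 1)
  have h3 := hs.summable.sum_add_tsum_nat_add (n + 1)
  rw [hs.tsum_eq] at h3
  have h4 : n * ∑' i, f (i + (n + 1)) ≤ ∑' i : ℕ, ((i + (n + 1) : ℕ) : ℝ) * f (i + (n + 1)) := by
    rw [← tsum_mul_left]
    refine Summable.tsum_le_tsum (fun i => ?_)
      (((summable_nat_add_iff (n + 1)).2 hs.summable).mul_left _)
      ((summable_nat_add_iff (n + 1)).2 hm)
    refine mul_le_mul_of_nonneg_right ?_ (hf _)
    push_cast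
    linarith [Nat.cast_nonneg (α := ℝ) i]
  rw [h1, ← h2]
  have : 1 - ∑ i ∈ Finset.range (n + 1), f i = ∑' i, f (i + (n + 1)) := by linarith
  rw [this]
  linarith

/-- Conservation of mass: at every time `n`, the last renewal before `n` is at some `n - i` and the
next one comes after `n`. -/
lemma renewal_tail_convolution
    (hu : ∀ n, u n = (if n = 0 then 1 else 0) + ∑ ij ∈ antidiagonal n, f ij.1 * u ij.2)
    (n : ℕ) :
    ∑ ij ∈ antidiagonal n, (1 - ∑ i ∈ Finset.range (ij.1 + 1), f i) * u ij.2 = 1 := by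
  set τ : ℕ → ℝ := fun n => 1 - ∑ i ∈ Finset.range (n + 1), f i with hτ
  have h1 : PowerSeries.mk τ * (1 - PowerSeries.X) = 1 - PowerSeries.mk f := by
    ext n
    cases n with
    | zero => simp [mul_sub, hτ]
    | succ n =>
      simp only [mul_sub, mul_one, map_sub, PowerSeries.coeff_succ_mul_X, PowerSeries.coeff_mk,
        PowerSeries.coeff_one, hτ]
      rw [Finset.sum_range_succ f (n + 1)]
      simp
  have h2 : PowerSeries.mk u * (1 - PowerSeries.mk f) = 1 := by
    ext n
    have := hu n
    rw [mul_sub, mul_one, map_sub, mul_comm, PowerSeries.coeff_mul, PowerSeries.coeff_one]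
    simp only [PowerSeries.coeff_mk]
    linarith
  have h3 : PowerSeries.mk τ * PowerSeries.mk u = PowerSeries.mk 1 := by
    have e := PowerSeries.mk_one_mul_one_sub_eq_one ℝ
    calc PowerSeries.mk τ * PowerSeries.mk u
        = (PowerSeries.mk 1 * (1 - PowerSeries.X)) * (PowerSeries.mk τ * PowerSeries.mk u) := by
          rw [e, one_mul]
      _ = PowerSeries.mk 1 * (PowerSeries.mk u * (PowerSeries.mk τ * (1 - PowerSeries.X))) := by
          ring
      _ = PowerSeries.mk 1 := by rw [h1, h2, mul_one]
  have := congrArg (PowerSeries.coeff n) h3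
  simpa [PowerSeries.coeff_mul] using this

/-- Dominated convergence for a convolution `∑ i ≤ n, s i * u (n - i)` along a filter for which
each shift of `u` converges. -/
lemma tendsto_convolution {s : ℕ → ℝ} {C : ℝ} (hs : Summable fun n => |s n|)
    (hu : ∀ n, |u n| ≤ C) {F : Filter ℕ} (hF : F ≤ atTop) {y : ℕ → ℝ}
    (hy : ∀ j, Tendsto (fun n => u (n - j)) F (𝓝 (y j))) :
    Tendsto (fun n => ∑ ij ∈ antidiagonal n, s ij.1 * u ij.2) F
      (𝓝 (∑' j, s j * y j)) := by
  have h : ∀ n, ∑ ij ∈ antidiagonal n, s ij.1 * u ij.2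
      = ∑' j, if j ≤ n then s j * u (n - j) else 0 := by
    intro n
    rw [Finset.Nat.sum_antidiagonal_eq_sum_range_succ (fun i j => s i * u j),
      tsum_eq_sum (s := Finset.range (n + 1))]
    · refine Finset.sum_congr rfl fun i hi => ?_
      rw [if_pos (Nat.lt_succ_iff.1 (Finset.mem_range.1 hi))]
    · intro i hi
      rw [if_neg]
      simpa [Nat.lt_succ_iff] using hi
  simp_rw [h]
  refine tendsto_tsum_of_dominated_convergence (bound := fun j => |s j| * C) (hs.mul_right C)
    (fun j => ?_) (Eventually.of_forall fun n j => ?_)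
  · refine ((hy j).const_mul (s j)).congr' ?_
    filter_upwards [hF (eventually_ge_atTop j)] with n hn
    rw [if_pos hn]
  · have hC : 0 ≤ C := (abs_nonneg _).trans (hu 0)
    split_ifs
    · rw [Real.norm_eq_abs, abs_mul]
      exact mul_le_mul_of_nonneg_left (hu _) (abs_nonneg _)
    · simpa using mul_nonneg (abs_nonneg _) hC

/-- The renewal theorem for a renewal sequence with `f 1 > 0` and finite mean. An extremal limit
point `y 0` of `u` is a limit along an ultrafilter along which all shifts `u (· - j)` converge as
well, to `y j` say. By the renewal equation `y i` is the `f`-average of the `y (i + j)`, so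
extremality and `f 1 > 0` propagate and all `y j` agree; conservation of mass then determines their
common value. -/
theorem renewal_tendsto (hf : ∀ n, 0 ≤ f n) (h0 : f 0 = 0) (h1 : 0 < f 1) (hs : HasSum f 1)
    (hm : Summable fun n : ℕ => n * f n)
    (hu : ∀ n, u n = (if n = 0 then 1 else 0) + ∑ ij ∈ antidiagonal n, f ij.1 * u ij.2) :
    ∃ l : ℝ, 0 < l ∧ Tendsto u atTop (𝓝 l) := by
  set τ : ℕ → ℝ := fun n => 1 - ∑ i ∈ Finset.range (n + 1), f i with hτ
  have hτs : Summable τ := summable_tail hf hs hm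
  have hτ0 : ∀ n, 0 ≤ τ n := fun n => sub_nonneg.2 (sum_le_hasSum _ (fun i _ => hf i) hs)
  have hT : 0 < ∑' j, τ j :=
    hτs.tsum_pos hτ0 0 (by simp [hτ, h0])
  have hu01 := renewal_mem_Icc hf h0 (fun n => sum_le_hasSum _ (fun i _ => hf i) hs) hu
  have huabs : ∀ n, |u n| ≤ 1 := fun n => abs_le.2 ⟨by linarith [(hu01 n).1], (hu01 n).2⟩
  have hfabs : Summable fun n => |f n| := by simpa only [abs_of_nonneg (hf _)] using hs.summable
  have hτabs : Summable fun n => |τ n| := by simpa only [abs_of_nonneg (hτ0 _)] using hτs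
  -- the set of limit points of `u`
  set S : Set ℝ := {y | MapClusterPt y atTop u} with hS
  have hSclosed : IsClosed S := isClosed_setOfPred_clusterPt
  have hSsub : S ⊆ Set.Icc 0 1 := fun y hy =>
    isClosed_Icc.mem_of_mapClusterPt hy (Eventually.of_forall hu01)
  have hScomp : IsCompact S := isCompact_Icc.of_isClosed_subset hSclosed hSsub
  have hSne : S.Nonempty := by
    obtain ⟨y, -, hy⟩ := isCompact_Icc.exists_mapClusterPt (f := atTop) (u := u)
      (by simpa using Eventually.of_forall (f := atTop) hu01)
    exact ⟨y, hy⟩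
  have key : ∀ y₀ ∈ S, ((∀ z ∈ S, z ≤ y₀) ∨ ∀ z ∈ S, y₀ ≤ z) → y₀ * ∑' j, τ j = 1 := by
    intro y₀ hy₀ hext
    obtain ⟨F, hF, hFu⟩ := mapClusterPt_iff_ultrafilter.1 hy₀
    have hlim : ∀ j, ∃ y, Tendsto (fun n => u (n - j)) F (𝓝 y) := by
      intro j
      obtain ⟨y, -, hy⟩ := isCompact_Icc.ultrafilter_le_nhds' (F.map fun n => u (n - j))
        (Ultrafilter.mem_map.2 (Filter.mem_of_superset Filter.univ_mem fun n _ => hu01 (n - j)))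
      exact ⟨y, hy⟩
    choose y hy using hlim
    have hy0 : y 0 = y₀ := tendsto_nhds_unique (hy 0) hFu
    have hyS : ∀ j, y j ∈ S := fun j =>
      ((hy j).mapClusterPt (u := fun n => u (n - j))).mono hF |>.of_comp
        (φ := fun n => n - j) (tendsto_sub_atTop_nat j)
    have hyb : ∀ j, |y j| ≤ 1 := fun j =>
      abs_le.2 ⟨by linarith [(hSsub (hyS j)).1], (hSsub (hyS j)).2⟩
    have havg : ∀ i, y i = ∑' j, f j * y (i + j) := by
      intro i
      have h2 := tendsto_convolution (u := u) hfabs huabs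
        ((tendsto_sub_atTop_nat i).mono_left hF : Tendsto _ _ _) (y := fun j => y (i + j))
        (fun j => by
          rw [tendsto_map'_iff]
          refine (hy (i + j)).congr fun n => ?_
          simp [Nat.sub_sub])
      rw [tendsto_map'_iff] at h2
      refine tendsto_nhds_unique (hy i) (h2.congr' ?_)
      filter_upwards [hF (eventually_gt_atTop i)] with n hn
      have := hu (n - i)
      rw [if_neg (by omega), zero_add] at this
      exact this.symm
    have hconst : ∀ i, y i = y₀ := by
      intro i
      induction i with
      | zero => exact hy0
      | succ i ih =>
        have hsum : Summable fun j => f j * y (i + j) :=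
          Summable.of_norm_bounded hfabs fun j => by
            rw [Real.norm_eq_abs, abs_mul]
            exact mul_le_of_le_one_right (abs_nonneg _) (hyb _)
        have h2 : HasSum (fun j => f j * (y₀ - y (i + j))) 0 := by
          have h3 := (hs.mul_right y₀).sub hsum.hasSum
          rw [← havg i, ih, one_mul, sub_self] at h3
          simpa only [mul_sub] using h3
        have h4 : f 1 * (y₀ - y (i + 1)) = 0 := by
          rcases hext with hext | hext
          · exact (hasSum_zero_iff_of_nonneg fun j =>
              mul_nonneg (hf j) (sub_nonneg.2 (hext _ (hyS _)))).1 h2 |> fun h => congrFun h 1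
          · have h5 := h2.neg
            simp only [neg_zero, ← mul_neg, neg_sub] at h5
            have := congrFun ((hasSum_zero_iff_of_nonneg fun j =>
              mul_nonneg (hf j) (sub_nonneg.2 (hext _ (hyS (i + j))))).1 h5) 1
            simp only [Pi.zero_apply] at this
            linarith
        rcases mul_eq_zero.1 h4 with h | h
        · exact absurd h h1.ne'
        · linarith
    have h6 := tendsto_convolution (u := u) hτabs huabs hF hy
    have h7 : (fun n => ∑ ij ∈ antidiagonal n, τ ij.1 * u ij.2) = fun _ => 1 := by
      funext n
      exact renewal_tail_convolution hu n
    rw [h7] at h6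
    have h8 := tendsto_nhds_unique h6 tendsto_const_nhds
    simp only [hconst, tsum_mul_right] at h8
    rw [mul_comm]
    exact h8
  obtain ⟨M, hM, hMmax⟩ := hScomp.exists_isGreatest hSne
  obtain ⟨m, hm', hmin⟩ := hScomp.exists_isLeast hSne
  have eM := key M hM (Or.inl hMmax)
  have em := key m hm' (Or.inr hmin)
  have hMm : M = m := mul_right_cancel₀ hT.ne' (eM.trans em.symm)
  refine ⟨M, pos_of_mul_pos_left (by rw [eM]; exact one_pos) hT.le, ?_⟩
  refine isCompact_Icc.tendsto_nhds_of_unique_mapClusterPt (Eventually.of_forall hu01) ?_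
  intro z _ hz
  exact le_antisymm (hMmax hz) (hMm ▸ hmin hz)

end Renewal

/-! ### Absolutely convergent evaluation of power series -/

section AbsHasSum

/-- The power series `f` converges absolutely at the point `t`, with sum `s`. -/
def AbsHasSum (f : PowerSeries ℝ) (t s : ℝ) : Prop :=
  (Summable fun n => |PowerSeries.coeff n f * t ^ n|) ∧
    HasSum (fun n => PowerSeries.coeff n f * t ^ n) s

/-- All coefficients of the power series `f` are nonnegative. -/
def NonnegCoeff (f : PowerSeries ℝ) : Prop := ∀ n, 0 ≤ PowerSeries.coeff n f

variable {f g u : PowerSeries ℝ} {t a b r : ℝ}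

lemma coeff_mul_mul_pow (f g : PowerSeries ℝ) (t : ℝ) (n : ℕ) :
    PowerSeries.coeff n (f * g) * t ^ n = ∑ ij ∈ antidiagonal n,
      (PowerSeries.coeff ij.1 f * t ^ ij.1) * (PowerSeries.coeff ij.2 g * t ^ ij.2) := by
  rw [PowerSeries.coeff_mul, Finset.sum_mul]
  refine Finset.sum_congr rfl fun ij hij => ?_
  rw [← Finset.HasAntidiagonal.mem_antidiagonal.1 hij, pow_add]
  ring

namespace NonnegCoeff

lemma C (hr : 0 ≤ r) : NonnegCoeff (PowerSeries.C r) := by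
  intro n
  rw [PowerSeries.coeff_C]
  split_ifs <;> simp [hr]

lemma one : NonnegCoeff 1 := by
  simpa using C zero_le_one

lemma X : NonnegCoeff PowerSeries.X := by
  intro n
  rw [PowerSeries.coeff_X]
  split_ifs <;> simp

lemma add (hf : NonnegCoeff f) (hg : NonnegCoeff g) : NonnegCoeff (f + g) := fun n => by
  rw [map_add]
  exact add_nonneg (hf n) (hg n)

lemma mul (hf : NonnegCoeff f) (hg : NonnegCoeff g) : NonnegCoeff (f * g) := fun n => by
  rw [PowerSeries.coeff_mul]
  exact Finset.sum_nonneg fun ij _ => mul_nonneg (hf _) (hg _)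

lemma pow (hf : NonnegCoeff f) (n : ℕ) : NonnegCoeff (f ^ n) := by
  induction n with
  | zero => simpa using one
  | succ n ih => exact pow_succ f n ▸ ih.mul hf

lemma sum {ι : Type*} {s : Finset ι} {F : ι → PowerSeries ℝ} (h : ∀ i ∈ s, NonnegCoeff (F i)) :
    NonnegCoeff (∑ i ∈ s, F i) := fun n => by
  rw [map_sum]
  exact Finset.sum_nonneg fun i hi => h i hi n

lemma aeval {P : ℝ[X]} (hP : ∀ n, 0 ≤ P.coeff n) (hf : NonnegCoeff f) :
    NonnegCoeff (Polynomial.aeval f P) := by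
  rw [Polynomial.aeval_eq_sum_range]
  refine sum fun i _ n => ?_
  rw [PowerSeries.coeff_smul]
  exact mul_nonneg (hP i) (hf.pow i n)

lemma sum_range_le (hf : NonnegCoeff f) (ht : 0 ≤ t) (h : AbsHasSum f t a) (n : ℕ) :
    ∑ i ∈ Finset.range n, PowerSeries.coeff i f * t ^ i ≤ a :=
  sum_le_hasSum _ (fun i _ => mul_nonneg (hf i) (pow_nonneg ht i)) h.2

end NonnegCoeff

namespace AbsHasSum

lemma unique (hf : AbsHasSum f t a) (hg : AbsHasSum f t b) : a = b := hf.2.unique hg.2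

lemma C (r t : ℝ) : AbsHasSum (PowerSeries.C r) t r := by
  have h : ∀ n, n ≠ 0 → PowerSeries.coeff n (PowerSeries.C r) * t ^ n = 0 := fun n hn => by
    rw [PowerSeries.coeff_C, if_neg hn, zero_mul]
  refine ⟨summable_of_ne_finset_zero (s := {0}) fun n hn => ?_, ?_⟩
  · rw [h n (by simpa using hn), abs_zero]
  · simpa using hasSum_single 0 h

lemma one (t : ℝ) : AbsHasSum 1 t 1 := by simpa using C 1 t

lemma X (t : ℝ) : AbsHasSum PowerSeries.X t t := by
  have h : ∀ n, n ≠ 1 → PowerSeries.coeff n PowerSeries.X * t ^ n = 0 := fun n hn => by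
    rw [PowerSeries.coeff_X, if_neg hn, zero_mul]
  refine ⟨summable_of_ne_finset_zero (s := {1}) fun n hn => ?_, ?_⟩
  · rw [h n (by simpa using hn), abs_zero]
  · simpa using hasSum_single 1 h

lemma add (hf : AbsHasSum f t a) (hg : AbsHasSum g t b) : AbsHasSum (f + g) t (a + b) := by
  refine ⟨Summable.of_nonneg_of_le (fun _ => abs_nonneg _) (fun n => ?_) (hf.1.add hg.1), ?_⟩
  · rw [map_add, add_mul]
    exact abs_add_le _ _
  · simpa only [map_add, add_mul] using hf.2.add hg.2

lemma mul (hf : AbsHasSum f t a) (hg : AbsHasSum g t b) : AbsHasSum (f * g) t (a * b) := by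
  have h1 := summable_norm_sum_mul_antidiagonal_of_summable_norm
    (f := fun n => PowerSeries.coeff n f * t ^ n) (g := fun n => PowerSeries.coeff n g * t ^ n)
    hf.1 hg.1
  have h2 := tsum_mul_tsum_eq_tsum_sum_antidiagonal_of_summable_norm
    (f := fun n => PowerSeries.coeff n f * t ^ n) (g := fun n => PowerSeries.coeff n g * t ^ n)
    hf.1 hg.1
  unfold AbsHasSum
  simp only [coeff_mul_mul_pow]
  refine ⟨h1, ?_⟩
  rw [hf.2.tsum_eq, hg.2.tsum_eq] at h2
  rw [h2]
  exact (Summable.of_norm h1).hasSum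

lemma neg (hf : AbsHasSum f t a) : AbsHasSum (-f) t (-a) := by
  refine ⟨?_, ?_⟩
  · simpa using hf.1
  · simpa using hf.2.neg

lemma sub (hf : AbsHasSum f t a) (hg : AbsHasSum g t b) : AbsHasSum (f - g) t (a - b) := by
  rw [sub_eq_add_neg, sub_eq_add_neg]
  exact hf.add hg.neg

lemma pow (hf : AbsHasSum f t a) (n : ℕ) : AbsHasSum (f ^ n) t (a ^ n) := by
  induction n with
  | zero => simpa using one t
  | succ n ih => exact pow_succ f n ▸ pow_succ a n ▸ ih.mul hf

lemma aeval (hf : AbsHasSum f t a) (P : ℝ[X]) :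
    AbsHasSum (Polynomial.aeval f P) t (P.eval a) := by
  induction P using Polynomial.induction_on' with
  | add P Q hP hQ => simpa using hP.add hQ
  | monomial n r =>
    rw [Polynomial.aeval_monomial, Polynomial.eval_monomial]
    exact (C r t).mul (hf.pow n)

/-- If the coefficients of `u`, scaled by the powers of `t`, converge, so do those of `f * u`. -/
lemma tendsto_coeff_mul (hf : AbsHasSum f t a)
    (hu : Tendsto (fun n => PowerSeries.coeff n u * t ^ n) atTop (𝓝 b)) :
    Tendsto (fun n => PowerSeries.coeff n (f * u) * t ^ n) atTop (𝓝 (a * b)) := by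
  obtain ⟨B, hB⟩ := (Metric.isBounded_range_of_tendsto _ hu).exists_norm_le
  have := tendsto_convolution (C := B) hf.1 (fun n => hB _ ⟨n, rfl⟩) le_rfl (y := fun _ => b)
    (fun j => hu.comp (tendsto_sub_atTop_nat j))
  rw [tsum_mul_right, hf.2.tsum_eq] at this
  simpa only [coeff_mul_mul_pow] using this

/-- Multiplication by an absolutely convergent series preserves bounded scaled coefficients. -/
lemma abs_coeff_mul_le (hf : AbsHasSum f t a) {B : ℝ}
    (hu : ∀ n, |PowerSeries.coeff n u * t ^ n| ≤ B)
    (n : ℕ) : |PowerSeries.coeff n (f * u) * t ^ n|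
      ≤ (∑' j, |PowerSeries.coeff j f * t ^ j|) * B := by
  have hB : 0 ≤ B := (abs_nonneg _).trans (hu 0)
  rw [coeff_mul_mul_pow]
  calc _ ≤ ∑ ij ∈ antidiagonal n, |PowerSeries.coeff ij.1 f * t ^ ij.1| * B := by
        refine (Finset.abs_sum_le_sum_abs _ _).trans (Finset.sum_le_sum fun ij _ => ?_)
        rw [abs_mul]
        exact mul_le_mul_of_nonneg_left (hu _) (abs_nonneg _)
    _ = (∑ j ∈ Finset.range (n + 1), |PowerSeries.coeff j f * t ^ j|) * B := by
        rw [← Finset.sum_mul, Finset.Nat.sum_antidiagonal_eq_sum_range_succ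
          (fun i _ => |PowerSeries.coeff i f * t ^ i|)]
    _ ≤ _ := by
        gcongr
        exact hf.1.sum_le_tsum _ fun _ _ => abs_nonneg _

lemma abs_coeff_mul_le_of_nonneg (h0 : NonnegCoeff f) (ht : 0 ≤ t) (hf : AbsHasSum f t a)
    {B : ℝ}
    (hu : ∀ n, |PowerSeries.coeff n u * t ^ n| ≤ B) (n : ℕ) :
    |PowerSeries.coeff n (f * u) * t ^ n| ≤ a * B := by
  have := hf.abs_coeff_mul_le hu n
  simp_rw [fun j => abs_of_nonneg (mul_nonneg (h0 j) (pow_nonneg ht j)), hf.2.tsum_eq] at this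
  exact this

end AbsHasSum

section Inverse

variable {K U : PowerSeries ℝ}

/-- The coefficients of `U = 1 / (1 - K)`, scaled by the powers of `t`, solve the renewal equation
of the scaled coefficients of `K`. -/
lemma scaled_renewal_eq (hU : U * (1 - K) = 1) (t : ℝ) (n : ℕ) :
    PowerSeries.coeff n U * t ^ n = (if n = 0 then 1 else 0) + ∑ ij ∈ antidiagonal n,
      (PowerSeries.coeff ij.1 K * t ^ ij.1) * (PowerSeries.coeff ij.2 U * t ^ ij.2) := by
  have h : U = 1 + K * U := by linear_combination hU
  rw [← coeff_mul_mul_pow]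
  nth_rewrite 1 [h]
  rw [map_add, add_mul, PowerSeries.coeff_one]
  split_ifs with hn <;> simp [hn]

lemma coeff_inverse_mem_Icc (hK : NonnegCoeff K) (hK0 : PowerSeries.coeff 0 K = 0) (ht : 0 ≤ t)
    (h : AbsHasSum K t a) (ha : a ≤ 1) (hU : U * (1 - K) = 1) (n : ℕ) :
    PowerSeries.coeff n U * t ^ n ∈ Set.Icc (0 : ℝ) 1 :=
  renewal_mem_Icc (fun n => mul_nonneg (hK n) (pow_nonneg ht n)) (by simp [hK0])
    (fun n => (hK.sum_range_le ht h n).trans ha) (scaled_renewal_eq hU t) n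

/-- If `K` has nonnegative coefficients and `K(t) < 1`, then `1 / (1 - K)` converges at `t`. -/
lemma AbsHasSum.inverse (hK : NonnegCoeff K) (hK0 : PowerSeries.coeff 0 K = 0) (ht : 0 ≤ t)
    (h : AbsHasSum K t a) (ha : a < 1) (hU : U * (1 - K) = 1) : ∃ s, AbsHasSum U t s := by
  have h0 := fun n => (coeff_inverse_mem_Icc hK hK0 ht h ha.le hU n).1
  have hsum : Summable fun n => PowerSeries.coeff n U * t ^ n := by
    refine summable_of_sum_range_le (c := 1 / (1 - a)) h0 fun n => ?_
    -- the partial sums are the coefficients of `S`, which solves `S = 1 / (1 - X) + K * S`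
    set V := PowerSeries.rescale t U with hV
    set L := PowerSeries.rescale t K with hL
    set S := PowerSeries.mk 1 * V with hS
    have hcS : ∀ n, PowerSeries.coeff n S
        = ∑ i ∈ Finset.range (n + 1), PowerSeries.coeff i U * t ^ i := by
      intro n
      rw [hS, mul_comm, PowerSeries.coeff_mul,
        Finset.Nat.sum_antidiagonal_eq_sum_range_succ_mk]
      refine Finset.sum_congr rfl fun i _ => ?_
      simp [hV, mul_comm]
    have hSeq : S = PowerSeries.mk 1 + L * S := by
      have : V * (1 - L) = 1 := by rw [hV, hL, ← map_one (PowerSeries.rescale t), ← map_sub,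
        ← map_mul, hU]
      rw [hS]
      linear_combination (PowerSeries.mk 1) * this
    have hle : ∀ n, PowerSeries.coeff n S ≤ 1 / (1 - a) := by
      intro n
      induction n using Nat.strong_induction_on with
      | _ n ih =>
        rw [hSeq, map_add, PowerSeries.coeff_mk, PowerSeries.coeff_mul]
        have h1 : ∑ ij ∈ antidiagonal n, PowerSeries.coeff ij.1 L * PowerSeries.coeff ij.2 S
            ≤ ∑ ij ∈ antidiagonal n, (PowerSeries.coeff ij.1 K * t ^ ij.1) * (1 / (1 - a)) := by
          refine Finset.sum_le_sum fun ij hij => ?_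
          rw [Finset.HasAntidiagonal.mem_antidiagonal] at hij
          rcases Nat.eq_zero_or_pos ij.1 with h | h
          · simp [hL, h, hK0]
          · rw [hL, PowerSeries.coeff_rescale, mul_comm (t ^ _)]
            exact mul_le_mul_of_nonneg_left (ih _ (by omega))
              (mul_nonneg (hK _) (pow_nonneg ht _))
        rw [← Finset.sum_mul, Finset.Nat.sum_antidiagonal_eq_sum_range_succ
          (fun i _ => PowerSeries.coeff i K * t ^ i)] at h1
        have h2 := mul_le_mul_of_nonneg_right (hK.sum_range_le ht h (n + 1))
          (one_div_nonneg.2 (sub_nonneg.2 ha.le))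
        have h3 : 1 + a * (1 / (1 - a)) = 1 / (1 - a) := by
          field_simp [(sub_pos.2 ha).ne']
          ring
        simp only [Pi.one_apply]
        linarith
    cases n with
    | zero => simpa using one_div_nonneg.2 (sub_nonneg.2 ha.le)
    | succ n => exact hcS n ▸ hle n
  exact ⟨_, by simpa only [abs_of_nonneg (h0 _)] using hsum, hsum.hasSum⟩

end Inverse
end AbsHasSum

/-! ### The kernel polynomial -/

section Kernel

/-- The numbers `sin (j π / k) / sin (π / k)`, the solution of the recurrence
`c (j + 2) = λ_k * c (j + 1) - c j` with `c 0 = 0` and `c 1 = 1`. -/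
noncomputable def sineRatio (k j : ℕ) : ℝ :=
  Real.sin (j * (Real.pi / k)) / Real.sin (Real.pi / k)

/-- The polynomial `∑ i < k - 1, sineRatio k (i + s) X ^ i`. -/
noncomputable def sinePoly (k s : ℕ) : ℝ[X] :=
  ∑ i ∈ Finset.range (k - 1), C (sineRatio k (i + s)) * X ^ i

/-- A polynomial `K` with nonnegative coefficients for which `1 - K x` is, up to the positive factor
`1 - λ_k q x + (q x) ^ 2`, the reciprocal polynomial of `polyP k p`; here `q = 1 - p`. -/
noncomputable def kernelPoly (k : ℕ) (p : ℝ) : ℝ[X] :=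
  C (lambdaK k * p) * X * (sinePoly k 1).comp (C (1 - p) * X) +
    (C p * X) ^ 2 * (sinePoly k 1 + X ^ (k - 1) * sinePoly k 2).comp (C (1 - p) * X)

/-- The reciprocal polynomial of `polyP k p`, as a function. -/
noncomputable def deltaFun (k : ℕ) (p x : ℝ) : ℝ :=
  1 - (p * (1 - p) ^ (k - 1) * x ^ k) ^ 2
    - lambdaK k * x * (1 + p * (1 - p) ^ (k - 1) * x ^ k) - (2 * p - 1) * x ^ 2

variable {k : ℕ} {p : ℝ}

lemma sin_pi_div_pos (hk : 3 ≤ k) : 0 < Real.sin (Real.pi / k) := by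
  have hk' : (3 : ℝ) ≤ k := by exact_mod_cast hk
  apply Real.sin_pos_of_pos_of_lt_pi (by positivity)
  rw [div_lt_iff₀ (by positivity)]
  nlinarith [Real.pi_pos]

lemma one_le_lambdaK (hk : 3 ≤ k) : 1 ≤ lambdaK k := by
  have hk' : (3 : ℝ) ≤ k := by exact_mod_cast hk
  have h : Real.cos (Real.pi / 3) ≤ Real.cos (Real.pi / k) :=
    Real.cos_le_cos_of_nonneg_of_le_pi (by positivity) (by linarith [Real.pi_pos])
      (by gcongr)
  rw [Real.cos_pi_div_three] at h
  unfold lambdaK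
  linarith

lemma lambdaK_lt_two (hk : 3 ≤ k) : lambdaK k < 2 := by
  have hk' : (3 : ℝ) ≤ k := by exact_mod_cast hk
  have h : Real.cos (Real.pi / k) < Real.cos 0 :=
    Real.cos_lt_cos_of_nonneg_of_le_pi le_rfl
      (div_le_self Real.pi_pos.le (by linarith)) (by positivity)
  rw [Real.cos_zero] at h
  unfold lambdaK
  linarith

@[simp] lemma sineRatio_zero : sineRatio k 0 = 0 := by simp [sineRatio]

lemma sineRatio_one (hk : 3 ≤ k) : sineRatio k 1 = 1 := by
  simp [sineRatio, (sin_pi_div_pos hk).ne']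

lemma sineRatio_add_two (k j : ℕ) :
    sineRatio k (j + 2) = lambdaK k * sineRatio k (j + 1) - sineRatio k j := by
  unfold sineRatio lambdaK
  set θ := Real.pi / k
  rw [← mul_div_assoc (2 * Real.cos θ), ← sub_div]
  congr 1
  have e1 : ((j + 2 : ℕ) : ℝ) * θ = ((j + 1 : ℕ) : ℝ) * θ + θ := by push_cast; ring
  have e2 : (j : ℝ) * θ = ((j + 1 : ℕ) : ℝ) * θ - θ := by push_cast; ring
  rw [e1, e2, Real.sin_add, Real.sin_sub]
  ring

lemma sineRatio_self (hk : 3 ≤ k) : sineRatio k k = 0 := by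
  have hk' : (k : ℝ) ≠ 0 := by positivity
  unfold sineRatio
  rw [mul_div_cancel₀ _ hk', Real.sin_pi, zero_div]

lemma sineRatio_pred (hk : 3 ≤ k) : sineRatio k (k - 1) = 1 := by
  have hk' : (k : ℝ) ≠ 0 := by positivity
  unfold sineRatio
  rw [Nat.cast_sub (by omega), sub_mul, mul_div_cancel₀ _ hk', Nat.cast_one, one_mul,
    Real.sin_pi_sub, div_self (sin_pi_div_pos hk).ne']

lemma sineRatio_nonneg (hk : 3 ≤ k) {j : ℕ} (hj : j ≤ k) : 0 ≤ sineRatio k j := by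
  have hk' : (0 : ℝ) < k := by positivity
  refine div_nonneg (Real.sin_nonneg_of_nonneg_of_le_pi (by positivity) ?_) (sin_pi_div_pos hk).le
  have : (j : ℝ) ≤ k := by exact_mod_cast hj
  rw [mul_div_assoc', div_le_iff₀ hk', mul_comm]
  gcongr

lemma coeff_sinePoly_nonneg (hk : 3 ≤ k) {s : ℕ} (hs : s ≤ 2) (n : ℕ) :
    0 ≤ (sinePoly k s).coeff n := by
  unfold sinePoly
  rw [Polynomial.finsetSum_coeff]
  refine Finset.sum_nonneg fun i hi => ?_
  rw [Finset.mem_range] at hi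
  rw [coeff_C_mul_X_pow]
  split_ifs
  · exact sineRatio_nonneg hk (by omega)
  · exact le_rfl

lemma sinePoly_zero_add_two (k : ℕ) :
    sinePoly k 0 + sinePoly k 2 = C (lambdaK k) * sinePoly k 1 := by
  unfold sinePoly
  rw [← Finset.sum_add_distrib, Finset.mul_sum]
  refine Finset.sum_congr rfl fun i _ => ?_
  rw [sineRatio_add_two]
  simp only [C_sub, C_mul, add_zero]
  ring

/-- Multiplication by the characteristic polynomial of the recurrence makes the sum telescope. -/
lemma charPoly_mul_sum (k s n : ℕ) :
    (1 - C (lambdaK k) * X + X ^ 2) * ∑ i ∈ Finset.range (n + 1), C (sineRatio k (i + s)) * X ^ i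
      = C (sineRatio k s) + C (sineRatio k (s + 1) - lambdaK k * sineRatio k s) * X
        - C (sineRatio k (s + n + 1)) * X ^ (n + 1) + C (sineRatio k (s + n)) * X ^ (n + 2) := by
  induction n with
  | zero =>
    simp only [zero_add, Finset.sum_range_one, pow_zero, C_sub, C_mul, add_zero]
    ring
  | succ n ih =>
    rw [Finset.sum_range_succ, mul_add, ih, show n + 1 + s = s + n + 1 by ring,
      show s + (n + 1) + 1 = s + n + 2 by ring, sineRatio_add_two k (s + n),
      show s + (n + 1) = s + n + 1 by ring]
    simp only [C_sub, C_mul]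
    ring

lemma charPoly_mul_sinePoly (hk : 3 ≤ k) :
    (1 - C (lambdaK k) * X + X ^ 2) * sinePoly k 0 = X - X ^ (k - 1) + C (lambdaK k) * X ^ k ∧
    (1 - C (lambdaK k) * X + X ^ 2) * sinePoly k 1 = 1 + X ^ k ∧
    (1 - C (lambdaK k) * X + X ^ 2) * sinePoly k 2 = C (lambdaK k) - X + X ^ (k - 1) := by
  obtain ⟨n, rfl⟩ : ∃ n, k = n + 2 := ⟨k - 2, by omega⟩
  have h1 := sineRatio_one hk
  have h2 := sineRatio_add_two (n + 2) 0
  have h3 := sineRatio_add_two (n + 2) 1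
  have hp := sineRatio_pred hk
  have hs := sineRatio_self hk
  have hr := sineRatio_add_two (n + 2) n
  have hr' := sineRatio_add_two (n + 2) (n + 1)
  simp only [Nat.add_succ_sub_one, zero_add, sineRatio_zero] at *
  rw [show n + 1 + 1 = n + 2 from rfl] at hr'
  rw [hs, hp] at hr hr'
  have hn : sineRatio (n + 2) n = lambdaK (n + 2) := by linarith
  have hn3 : sineRatio (n + 2) (n + 3) = -1 := by
    rw [show n + 3 = n + 1 + 2 from rfl, hr']
    ring
  refine ⟨?_, ?_, ?_⟩
  · rw [sinePoly, show n + 2 - 1 = n + 1 from rfl, charPoly_mul_sum]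
    simp [h1, hp, hn]
  · rw [sinePoly, show n + 2 - 1 = n + 1 from rfl, charPoly_mul_sum,
      show 1 + n + 1 = n + 2 by ring, show 1 + n = n + 1 by ring, hs, hp, show 1 + 1 = 2 from rfl,
      h2, h1]
    simp
  · rw [sinePoly, show n + 2 - 1 = n + 1 from rfl, charPoly_mul_sum,
      show 2 + n + 1 = n + 3 by ring, show 2 + n = n + 2 by ring, hs, hn3,
      show 2 + 1 = 1 + 2 from rfl, h3, show 1 + 1 = 2 from rfl, h2, h1]
    simp
    ring

/-- A quadratic (Turán type) identity: `c (i + 1) ^ 2 - c i * c (i + 2) = 1` in generating function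
form. -/
lemma sinePoly_one_sq_sub (hk : 3 ≤ k) :
    sinePoly k 1 ^ 2 - sinePoly k 0 * sinePoly k 2
      = sinePoly k 1 + X ^ (k - 1) * sinePoly k 2 := by
  obtain ⟨h0, h1, h2⟩ := charPoly_mul_sinePoly hk
  have hk1 : (X : ℝ[X]) ^ k = X * X ^ (k - 1) := by
    rw [← pow_succ', Nat.sub_add_cancel (by omega)]
  have hN : (1 - C (lambdaK k) * X + X ^ 2 : ℝ[X]) ≠ 0 := by
    intro h
    have := congrArg (eval 0) h
    simp at this
  rw [hk1] at h0 h1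
  refine mul_left_cancel₀ (pow_ne_zero 2 hN) ?_
  set N : ℝ[X] := 1 - C (lambdaK k) * X + X ^ 2 with hNdef
  set Z : ℝ[X] := X ^ (k - 1)
  have e : N ^ 2 * (sinePoly k 1 ^ 2 - sinePoly k 0 * sinePoly k 2)
      = (N * sinePoly k 1) ^ 2 - (N * sinePoly k 0) * (N * sinePoly k 2) := by ring
  have e' : N ^ 2 * (sinePoly k 1 + Z * sinePoly k 2)
      = N * (N * sinePoly k 1 + Z * (N * sinePoly k 2)) := by ring
  rw [e, e', h0, h1, h2, hNdef]
  ring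

section Algebra

variable {S : Type*} [CommRing S] [Algebra ℝ S]

lemma aeval_kernelPoly (k : ℕ) (p : ℝ) (x : S) :
    aeval x (kernelPoly k p) =
      algebraMap ℝ S (lambdaK k) * (algebraMap ℝ S p * x) *
          aeval (algebraMap ℝ S (1 - p) * x) (sinePoly k 1) +
        (algebraMap ℝ S p * x) ^ 2 * (aeval (algebraMap ℝ S (1 - p) * x) (sinePoly k 1) +
          (algebraMap ℝ S (1 - p) * x) ^ (k - 1) *
            aeval (algebraMap ℝ S (1 - p) * x) (sinePoly k 2)) := by
  simp only [kernelPoly, map_add, map_mul, map_pow, aeval_C, aeval_X, aeval_comp]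
  ring

/-- `1 - K` is the determinant of `1 - M` for the symmetric matrix `M` with rows `(A, B)` and
`(B, G)`, where `A`, `B`, `G` are `p x` times the sine polynomials at `q x`. -/
lemma one_sub_aeval_kernelPoly (hk : 3 ≤ k) (p : ℝ) (x : S) :
    1 - aeval x (kernelPoly k p) =
      (1 - algebraMap ℝ S p * x * aeval (algebraMap ℝ S (1 - p) * x) (sinePoly k 0)) *
        (1 - algebraMap ℝ S p * x * aeval (algebraMap ℝ S (1 - p) * x) (sinePoly k 2)) -
        (algebraMap ℝ S p * x * aeval (algebraMap ℝ S (1 - p) * x) (sinePoly k 1)) ^ 2 := by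
  have h1 := congrArg (aeval (algebraMap ℝ S (1 - p) * x)) (sinePoly_one_sq_sub hk)
  have h2 := congrArg (aeval (algebraMap ℝ S (1 - p) * x)) (sinePoly_zero_add_two k)
  rw [aeval_kernelPoly]
  simp only [map_sub, map_add, map_mul, map_pow, aeval_C, aeval_X] at h1 h2 ⊢
  linear_combination (algebraMap ℝ S p * x) ^ 2 * h1 + (algebraMap ℝ S p * x) * h2

end Algebra

lemma eval_kernelPoly (k : ℕ) (p x : ℝ) :
    (kernelPoly k p).eval x = lambdaK k * (p * x) * (sinePoly k 1).eval ((1 - p) * x) +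
      (p * x) ^ 2 * ((sinePoly k 1).eval ((1 - p) * x) +
        ((1 - p) * x) ^ (k - 1) * (sinePoly k 2).eval ((1 - p) * x)) := by
  simpa [← Polynomial.coe_aeval_eq_eval] using aeval_kernelPoly k p x

lemma charPoly_pos (hk : 3 ≤ k) (w : ℝ) : 0 < 1 - lambdaK k * w + w ^ 2 := by
  nlinarith [one_le_lambdaK hk, lambdaK_lt_two hk, sq_nonneg (w - lambdaK k / 2)]

lemma charPoly_mul_one_sub_kernelPoly (hk : 3 ≤ k) (p x : ℝ) :
    (1 - lambdaK k * ((1 - p) * x) + ((1 - p) * x) ^ 2) * (1 - (kernelPoly k p).eval x)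
      = deltaFun k p x := by
  obtain ⟨-, h1, h2⟩ := charPoly_mul_sinePoly hk
  have h1 := congrArg (eval ((1 - p) * x)) h1
  have h2 := congrArg (eval ((1 - p) * x)) h2
  simp only [eval_mul, eval_add, eval_sub, eval_one, eval_C, eval_X, eval_pow] at h1 h2
  rw [eval_kernelPoly, deltaFun]
  have hx : x ^ k = x * x ^ (k - 1) := by rw [← pow_succ', Nat.sub_add_cancel (by omega)]
  have hw : ((1 - p) * x) ^ k = (1 - p) * x * ((1 - p) ^ (k - 1) * x ^ (k - 1)) := by
    rw [← mul_pow, ← pow_succ', Nat.sub_add_cancel (by omega)]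
  rw [hw] at h1
  rw [hx]
  rw [mul_pow _ _ (k - 1)] at h2 ⊢
  linear_combination (-lambdaK k * (p * x) - (p * x) ^ 2) * h1
    - (p * x) ^ 2 * ((1 - p) ^ (k - 1) * x ^ (k - 1)) * h2

lemma one_lt_eval_kernelPoly_iff (hk : 3 ≤ k) {x : ℝ} :
    1 < (kernelPoly k p).eval x ↔ deltaFun k p x < 0 := by
  rw [← charPoly_mul_one_sub_kernelPoly hk, ← sub_neg]
  have := charPoly_pos hk ((1 - p) * x)
  exact ⟨fun h => mul_neg_of_pos_of_neg this h, fun h => (pos_iff_neg_of_mul_neg h).1 this⟩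

lemma eval_polyP (hk : 3 ≤ k) {x : ℝ} (hx : x ≠ 0) :
    (polyP k p).eval x = x ^ (2 * k) * deltaFun k p x⁻¹ := by
  obtain ⟨n, rfl⟩ : ∃ n, k = n + 1 := ⟨k - 1, by omega⟩
  simp only [polyP, deltaFun, eval_sub, eval_mul, eval_pow, eval_X, eval_C,
    show 2 * (n + 1) - 1 = 2 * n + 1 by omega, show 2 * (n + 1) - 2 = 2 * n by omega,
    Nat.add_sub_cancel, inv_pow]
  field_simp
  ring

lemma isRoot_polyP_iff (hk : 3 ≤ k) {x : ℝ} (hx : 0 < x) :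
    (polyP k p).IsRoot x ↔ (kernelPoly k p).eval x⁻¹ = 1 := by
  rw [IsRoot, eval_polyP hk hx.ne', ← charPoly_mul_one_sub_kernelPoly hk, mul_eq_zero,
    or_iff_right (pow_pos hx _).ne', mul_eq_zero, or_iff_right (charPoly_pos hk _).ne', sub_eq_zero,
    eq_comm]

lemma eval_mono_of_coeff_nonneg {P : ℝ[X]} (hP : ∀ n, 0 ≤ P.coeff n) {x y : ℝ} (hx : 0 ≤ x)
    (hxy : x ≤ y) : P.eval x ≤ P.eval y := by
  rw [eval_eq_sum_range, eval_eq_sum_range]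
  exact Finset.sum_le_sum fun i _ => mul_le_mul_of_nonneg_left (pow_le_pow_left₀ hx hxy i) (hP i)

lemma eval_nonneg_of_coeff_nonneg {P : ℝ[X]} (hP : ∀ n, 0 ≤ P.coeff n) {x : ℝ} (hx : 0 ≤ x) :
    0 ≤ P.eval x := by
  rw [eval_eq_sum_range]
  exact Finset.sum_nonneg fun i _ => mul_nonneg (hP i) (pow_nonneg hx i)

lemma one_le_eval_sinePoly_one (hk : 3 ≤ k) {w : ℝ} (hw : 0 ≤ w) :
    1 ≤ (sinePoly k 1).eval w := by
  refine le_trans (le_of_eq ?_)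
    (eval_mono_of_coeff_nonneg (coeff_sinePoly_nonneg hk one_le_two) le_rfl hw)
  rw [← coeff_zero_eq_eval_zero, sinePoly, Polynomial.finsetSum_coeff,
    Finset.sum_eq_single_of_mem 0 (by simp; omega)]
  · simp [sineRatio_one hk]
  · intro i _ hi
    rw [coeff_C_mul_X_pow, if_neg hi.symm]

lemma kernelPoly_strictMonoOn (hk : 3 ≤ k) (hp : 0 < p) (hp1 : p ≤ 1) :
    StrictMonoOn (fun x => (kernelPoly k p).eval x) (Set.Ici 0) := by
  intro x hx y hy hxy
  have hx : 0 ≤ x := hx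
  have hq : 0 ≤ 1 - p := by linarith
  have hw : 0 ≤ (1 - p) * x := mul_nonneg hq hx
  have hwy : (1 - p) * x ≤ (1 - p) * y := mul_le_mul_of_nonneg_left hxy.le hq
  have hl := one_le_lambdaK hk
  have b1 := one_le_eval_sinePoly_one hk hw
  have m1 := eval_mono_of_coeff_nonneg (coeff_sinePoly_nonneg hk one_le_two) hw hwy
  have m2 := eval_mono_of_coeff_nonneg (coeff_sinePoly_nonneg hk le_rfl) hw hwy
  have n2 := eval_nonneg_of_coeff_nonneg (coeff_sinePoly_nonneg hk le_rfl) hw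
  simp only [eval_kernelPoly]
  refine add_lt_add_of_lt_of_le ?_ ?_
  · refine mul_lt_mul (by gcongr) m1 (by linarith) ?_
    have := hx.trans hxy.le
    positivity
  · refine mul_le_mul (by gcongr) ?_ ?_ (by positivity)
    · exact add_le_add m1 (mul_le_mul (pow_le_pow_left₀ hw hwy _) m2 n2
        (pow_nonneg (hw.trans hwy) _))
    · have := pow_nonneg hw (k - 1)
      positivity

lemma kernelPoly_mono (hk : 3 ≤ k) (hp : 0 ≤ p) (hp1 : p ≤ 1) {x y : ℝ} (hx : 0 ≤ x)
    (hxy : x ≤ y) : (kernelPoly k p).eval x ≤ (kernelPoly k p).eval y := by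
  rcases hp.eq_or_lt with rfl | hp
  · simp [eval_kernelPoly]
  · exact (kernelPoly_strictMonoOn hk hp hp1).monotoneOn hx (hx.trans hxy) hxy

lemma eval_kernelPoly_zero (k : ℕ) (p : ℝ) : (kernelPoly k p).eval 0 = 0 := by
  simp [eval_kernelPoly]

/-- At `x = 1 / q` the value of the kernel crosses `1` exactly when `p` crosses `criticalP k`. -/
lemma deltaFun_inv (hk : 3 ≤ k) (hp : p < 1) :
    deltaFun k p (1 - p)⁻¹ = 4 * (criticalP k - p) / (1 - p) ^ 2 := by
  obtain ⟨n, rfl⟩ : ∃ n, k = n + 1 := ⟨k - 1, by omega⟩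
  have hq : 1 - p ≠ 0 := by linarith
  simp only [deltaFun, criticalP, Nat.add_sub_cancel, inv_pow]
  field_simp
  ring

end Kernel

/-! ### The generating function of excursions -/

section Tree

/-- The iterates, started at `0`, of the fixed point equation `D = 1 + c X ^ k D ^ k`. -/
noncomputable def treeIter (k : ℕ) (c : ℝ) : ℕ → ℝ[X]
  | 0 => 0
  | N + 1 => 1 + C c * X ^ k * treeIter k c N ^ k

/-- The power series solution `D` of `D = 1 + c X ^ k D ^ k`. For `c = p q ^ (k - 1)` the
coefficient of `X ^ n` is the probability that the first `n` signs form a concatenation of complete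
excursions, that is, reduce to the empty word when blocks `+`, `-`, ..., `-` with `k - 1` minus
signs are cancelled. -/
noncomputable def treeSeries (k : ℕ) (c : ℝ) : PowerSeries ℝ :=
  PowerSeries.mk fun n => (treeIter k c (n + 1)).coeff n

variable {k : ℕ} {c t x y : ℝ}

lemma X_pow_dvd_treeIter_sub (hk : 0 < k) (c : ℝ) (N : ℕ) :
    X ^ N ∣ treeIter k c (N + 1) - treeIter k c N := by
  induction N with
  | zero => simp
  | succ N ih =>
    have h : treeIter k c (N + 2) - treeIter k c (N + 1)
        = C c * (X ^ k * (treeIter k c (N + 1) ^ k - treeIter k c N ^ k)) := by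
      simp only [treeIter]
      ring
    rw [h, pow_succ']
    exact dvd_mul_of_dvd_right
      (mul_dvd_mul (dvd_pow_self _ hk.ne') (ih.trans (sub_dvd_pow_sub_pow _ _ _))) _

lemma coeff_treeIter (hk : 0 < k) (c : ℝ) {n N : ℕ} (h : n < N) :
    (treeIter k c N).coeff n = PowerSeries.coeff n (treeSeries k c) := by
  rw [treeSeries, PowerSeries.coeff_mk]
  induction N, h using Nat.le_induction with
  | base => rfl
  | succ N hN ih =>
    rw [← ih, ← sub_eq_zero, ← coeff_sub]
    exact X_pow_dvd_iff.1 (X_pow_dvd_treeIter_sub hk c N) n hN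

lemma X_pow_dvd_treeSeries_sub (hk : 0 < k) (c : ℝ) (N : ℕ) :
    PowerSeries.X ^ N ∣ treeSeries k c - (treeIter k c N : PowerSeries ℝ) := by
  rw [PowerSeries.X_pow_dvd_iff]
  intro n hn
  rw [map_sub, Polynomial.coeff_coe, coeff_treeIter hk c hn, sub_self]

lemma treeSeries_eq (hk : 0 < k) (c : ℝ) :
    treeSeries k c = 1 + PowerSeries.C c * PowerSeries.X ^ k * treeSeries k c ^ k := by
  rw [← sub_eq_zero]
  ext n
  have h1 := X_pow_dvd_treeSeries_sub hk c (n + 2)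
  have h2 := X_pow_dvd_treeSeries_sub hk c (n + 1)
  have h3 : PowerSeries.X ^ (n + 1) ∣ treeSeries k c
      - (1 + PowerSeries.C c * PowerSeries.X ^ k * treeSeries k c ^ k) := by
    have e : treeSeries k c - (1 + PowerSeries.C c * PowerSeries.X ^ k * treeSeries k c ^ k)
        = (treeSeries k c - (treeIter k c (n + 2) : PowerSeries ℝ))
          - PowerSeries.C c * PowerSeries.X ^ k *
            (treeSeries k c ^ k - (treeIter k c (n + 1) : PowerSeries ℝ) ^ k) := by
      simp only [treeIter, Polynomial.coe_add, Polynomial.coe_mul, Polynomial.coe_pow,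
        Polynomial.coe_one, Polynomial.coe_C, Polynomial.coe_X]
      ring
    rw [e]
    exact dvd_sub ((pow_dvd_pow _ (by omega)).trans h1)
      (dvd_mul_of_dvd_right (h2.trans (sub_dvd_pow_sub_pow _ _ _)) _)
  rw [map_zero]
  exact PowerSeries.X_pow_dvd_iff.1 h3 n (by omega)

lemma coeff_treeIter_nonneg (hc : 0 ≤ c) (N n : ℕ) : 0 ≤ (treeIter k c N).coeff n := by
  suffices NonnegCoeff (treeIter k c N : PowerSeries ℝ) by simpa using this n
  induction N with
  | zero => intro n; simp [treeIter]
  | succ N ih =>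
    simp only [treeIter, Polynomial.coe_add, Polynomial.coe_mul, Polynomial.coe_pow,
        Polynomial.coe_one, Polynomial.coe_C, Polynomial.coe_X]
    exact NonnegCoeff.one.add (((NonnegCoeff.C hc).mul (NonnegCoeff.X.pow k)).mul (ih.pow k))

lemma nonnegCoeff_treeSeries (hc : 0 ≤ c) : NonnegCoeff (treeSeries k c) := fun n => by
  rw [treeSeries, PowerSeries.coeff_mk]
  exact coeff_treeIter_nonneg hc _ _

lemma coeff_zero_treeSeries (hk : 0 < k) (c : ℝ) : PowerSeries.coeff 0 (treeSeries k c) = 1 := by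
  rw [← coeff_treeIter hk c zero_lt_one]
  simp [treeIter, hk.ne']

lemma eval_treeIter_le (hc : 0 ≤ c) (ht : 0 ≤ t) (hy : 0 ≤ y) (h : 1 + c * t ^ k * y ^ k ≤ y)
    (N : ℕ) : (treeIter k c N).eval t ≤ y := by
  induction N with
  | zero => simpa [treeIter] using hy
  | succ N ih =>
    have h0 : 0 ≤ (treeIter k c N).eval t :=
      eval_nonneg_of_coeff_nonneg (coeff_treeIter_nonneg hc N) ht
    simp only [treeIter, eval_add, eval_one, eval_mul, eval_C, eval_pow, eval_X]
    refine le_trans ?_ h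
    gcongr

/-- The series `D` converges at `t` as soon as the fixed point equation at `t` has a nonnegative
supersolution `y`; its sum is then a solution not exceeding `y`. -/
lemma exists_absHasSum_treeSeries (hk : 0 < k) (hc : 0 ≤ c) (ht : 0 ≤ t) (hy : 0 ≤ y)
    (h : 1 + c * t ^ k * y ^ k ≤ y) :
    ∃ s, AbsHasSum (treeSeries k c) t s ∧ s ≤ y ∧ 1 ≤ s ∧ s = 1 + c * t ^ k * s ^ k := by
  have h0 : ∀ n, 0 ≤ PowerSeries.coeff n (treeSeries k c) * t ^ n := fun n =>
    mul_nonneg (nonnegCoeff_treeSeries hc n) (pow_nonneg ht n)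
  have hle : ∀ n, ∑ i ∈ Finset.range n, PowerSeries.coeff i (treeSeries k c) * t ^ i ≤ y := by
    intro n
    refine le_trans ?_ (eval_treeIter_le hc ht hy h n)
    rw [eval_eq_sum_range' (lt_max_of_lt_right (Nat.lt_succ_self _) :
      _ < max n ((treeIter k c n).natDegree + 1))]
    refine le_trans (Finset.sum_le_sum fun i hi => ?_) (Finset.sum_le_sum_of_subset_of_nonneg
      (Finset.range_mono (le_max_left _ _)) fun i _ _ =>
        mul_nonneg (coeff_treeIter_nonneg hc n i) (pow_nonneg ht i))
    rw [coeff_treeIter hk c (Finset.mem_range.1 hi)]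
  have hsum := summable_of_sum_range_le h0 hle
  have hD : AbsHasSum (treeSeries k c) t (∑' n, PowerSeries.coeff n (treeSeries k c) * t ^ n) :=
    ⟨by simpa only [abs_of_nonneg (h0 _)] using hsum, hsum.hasSum⟩
  refine ⟨_, hD, hsum.tsum_le_of_sum_range_le hle, ?_, ?_⟩
  · simpa [coeff_zero_treeSeries hk] using
      (nonnegCoeff_treeSeries hc).sum_range_le ht hD 1
  · have h2 := (AbsHasSum.one t).add
      (((AbsHasSum.C c t).mul ((AbsHasSum.X t).pow k)).mul (hD.pow k))
    rw [← treeSeries_eq hk] at h2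
    exact hD.unique h2

/-- The map `x ↦ x / (1 + c x ^ k)`, inverse to `t ↦ t D(t)`, is strictly increasing as long as
`(k - 1) c x ^ k ≤ 1`. -/
lemma div_one_add_lt (hk : 0 < k) (hc : 0 ≤ c) (hx : 0 ≤ x) (hxy : x < y)
    (hy : (k - 1) * (c * y ^ k) ≤ 1) : x / (1 + c * x ^ k) < y / (1 + c * y ^ k) := by
  obtain ⟨n, rfl⟩ : ∃ n, k = n + 1 := ⟨k - 1, by omega⟩
  have hy0 : 0 < y := hx.trans_lt hxy
  have hx' : 0 < 1 + c * x ^ (n + 1) := by positivity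
  have hy' : 0 < 1 + c * y ^ (n + 1) := by positivity
  rw [div_lt_div_iff₀ hx' hy']
  -- with `x = s * y` this is Bernoulli's inequality for `s ^ n`
  obtain ⟨s, rfl⟩ : ∃ s, x = s * y := ⟨x / y, by field_simp⟩
  have hs0 : 0 ≤ s := nonneg_of_mul_nonneg_left hx hy0
  have hs1 : s < 1 := by
    by_contra! h
    nlinarith
  have hB := one_add_mul_le_pow (a := s - 1) (by linarith) n
  rw [add_sub_cancel] at hB
  set d := c * y ^ (n + 1) with hd
  have hd0 : 0 ≤ d := by positivity
  have e : c * (s * y) ^ (n + 1) = d * (s * s ^ n) := by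
    rw [mul_pow, pow_succ' s, hd]
    ring
  rw [e]
  push_cast at hy
  have h1 : d * (s * (1 - s ^ n)) ≤ s * (1 - s) := by
    have : d * (1 - s ^ n) ≤ 1 - s := by
      nlinarith [mul_le_mul_of_nonneg_left hB hd0, mul_le_mul_of_nonneg_right hy
        (sub_nonneg.2 hs1.le)]
    nlinarith [mul_le_mul_of_nonneg_left this hs0]
  nlinarith [mul_pos hy0 (pow_pos (sub_pos.2 hs1) 2), mul_le_mul_of_nonneg_left h1 hy0.le,
    mul_nonneg hs0 hy0.le]

/-- The value of `D` at `t = x / (1 + c x ^ k)`. -/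
lemma absHasSum_treeSeries (hk : 0 < k) (hc : 0 ≤ c) (hx : 0 < x)
    (h : (k - 1) * (c * x ^ k) ≤ 1) :
    AbsHasSum (treeSeries k c) (x / (1 + c * x ^ k)) (1 + c * x ^ k) := by
  set y := 1 + c * x ^ k with hy
  have hy0 : 0 < y := by positivity
  have ht : 0 < x / y := by positivity
  have hxy : c * (x / y) ^ k * y ^ k = c * x ^ k := by
    rw [div_pow]
    field_simp
  obtain ⟨s, hs, hsy, hs1, hseq⟩ :=
    exists_absHasSum_treeSeries hk hc ht.le hy0.le (by rw [hxy])
  have hs0 : 0 < s := by linarith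
  suffices s = y by rwa [this] at hs
  refine hsy.antisymm (not_lt.1 fun hlt => ?_)
  have h1 : x / y * s < x := by
    rw [div_mul_eq_mul_div, div_lt_iff₀ hy0]
    exact mul_lt_mul_of_pos_left hlt hx
  have h2 := div_one_add_lt hk hc (by positivity) h1 h
  rw [mul_pow, ← mul_assoc, ← hseq, mul_div_cancel_right₀ _ hs0.ne'] at h2
  exact lt_irrefl _ h2

end Tree

/-! ### The walk on pairs of consecutive terms -/

section Walk

/-- The move `(g (n), g (n + 1)) ↦ (g (n + 1), g (n + 2))` for the sign `+`. -/
def stepPlus (lam : ℝ) (v : ℝ × ℝ) : ℝ × ℝ := (v.2, |lam * v.2 + v.1|)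

/-- The move `(g (n), g (n + 1)) ↦ (g (n + 1), g (n + 2))` for the sign `-`. -/
def stepMinus (lam : ℝ) (v : ℝ × ℝ) : ℝ × ℝ := (v.2, |lam * v.2 - v.1|)

/-- The expected value of the first coordinate after `n` random moves started at `v`. -/
noncomputable def meanFun (lam p : ℝ) : ℕ → ℝ × ℝ → ℝ
  | 0, v => v.1
  | n + 1, v => p * meanFun lam p n (stepPlus lam v)
      + (1 - p) * meanFun lam p n (stepMinus lam v)

variable {k : ℕ} {p lam : ℝ} {v : ℝ × ℝ}

lemma stepMinus_nonneg (hv : 0 ≤ v.2) : 0 ≤ (stepMinus lam v).1 ∧ 0 ≤ (stepMinus lam v).2 :=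
  ⟨hv, abs_nonneg _⟩

lemma meanFun_nonneg (hp0 : 0 ≤ p) (hp1 : p ≤ 1) (n : ℕ) {v : ℝ × ℝ} (h1 : 0 ≤ v.1)
    (h2 : 0 ≤ v.2) : 0 ≤ meanFun lam p n v := by
  induction n generalizing v with
  | zero => exact h1
  | succ n ih =>
    exact add_nonneg (mul_nonneg hp0 (ih h2 (abs_nonneg _)))
      (mul_nonneg (sub_nonneg.2 hp1) (ih h2 (abs_nonneg _)))

lemma meanFun_pos (hl : 0 ≤ lam) (hp0 : 0 < p) (hp1 : p ≤ 1) (n : ℕ) {v : ℝ × ℝ} (h1 : 0 < v.1)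
    (h2 : 0 < v.2) : 0 < meanFun lam p n v := by
  induction n generalizing v with
  | zero => exact h1
  | succ n ih =>
    refine add_pos_of_pos_of_nonneg (mul_pos hp0 (ih h2 ?_))
      (mul_nonneg (sub_nonneg.2 hp1) (meanFun_nonneg hp0.le hp1 n h2.le (abs_nonneg _)))
    exact abs_pos.2 (by positivity)

lemma iterate_stepMinus_nonneg (h1 : 0 ≤ v.1) (h2 : 0 ≤ v.2) (i : ℕ) :
    0 ≤ ((stepMinus lam)^[i] v).1 ∧ 0 ≤ ((stepMinus lam)^[i] v).2 := by
  induction i with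
  | zero => exact ⟨h1, h2⟩
  | succ i ih =>
    rw [Function.iterate_succ_apply']
    exact stepMinus_nonneg ih.2

/-- The iterates of `stepMinus` stay bounded since the positive definite quadratic form
`a ^ 2 + b ^ 2 - lam * a * b` does not increase. -/
lemma iterate_stepMinus_bounded (hl0 : 0 ≤ lam) (hl : lam < 2) (h1 : 0 ≤ v.1) (h2 : 0 ≤ v.2) :
    ∃ B, ∀ i, ((stepMinus lam)^[i] v).1 ≤ B ∧ ((stepMinus lam)^[i] v).2 ≤ B := by
  set Q : ℝ × ℝ → ℝ := fun v => v.1 ^ 2 + v.2 ^ 2 - lam * v.1 * v.2 with hQ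
  have hdec : ∀ i, Q ((stepMinus lam)^[i] v) ≤ Q v := by
    intro i
    induction i with
    | zero => exact le_rfl
    | succ i ih =>
      refine le_trans ?_ ih
      rw [Function.iterate_succ_apply']
      obtain ⟨-, hb⟩ := iterate_stepMinus_nonneg (lam := lam) h1 h2 i
      set z := (stepMinus lam)^[i] v
      simp only [hQ, stepMinus, sq_abs]
      nlinarith [mul_le_mul_of_nonneg_left (le_abs_self (lam * z.2 - z.1)) (mul_nonneg hl0 hb)]
  have hδ : 0 < 1 - lam / 2 := by linarith
  have hpos : ∀ a b : ℝ, (1 - lam / 2) * (a ^ 2 + b ^ 2) ≤ Q (a, b) := by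
    intro a b
    simp only [hQ]
    nlinarith [mul_nonneg hl0 (sq_nonneg (a - b))]
  refine ⟨1 + Q v / (1 - lam / 2), fun i => ?_⟩
  have h3 := (hpos _ _).trans (hdec i)
  rw [mul_comm, ← le_div_iff₀ hδ] at h3
  constructor
  all_goals nlinarith [sq_nonneg ((stepMinus lam)^[i] v).1, sq_nonneg ((stepMinus lam)^[i] v).2,
    sq_nonneg (((stepMinus lam)^[i] v).1 - 1), sq_nonneg (((stepMinus lam)^[i] v).2 - 1)]

/-- As long as no absolute value acts, the terms after a sign `+` are given by `sineRatio`. -/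
lemma iterate_stepMinus_stepPlus (hk : 3 ≤ k) (h1 : 0 ≤ v.1) (h2 : 0 ≤ v.2) {i : ℕ}
    (hi : i + 2 ≤ k) :
    (stepMinus (lambdaK k))^[i] (stepPlus (lambdaK k) v) =
      (sineRatio k i * v.1 + sineRatio k (i + 1) * v.2,
        sineRatio k (i + 1) * v.1 + sineRatio k (i + 2) * v.2) := by
  have hl := one_le_lambdaK hk
  induction i with
  | zero =>
    simp only [Function.iterate_zero, id, sineRatio_add_two, sineRatio_zero, zero_add,
      sineRatio_one hk, stepPlus]
    rw [abs_of_nonneg (by positivity)]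
    ext
    · simp
    · simp only
      ring
  | succ i ih =>
    rw [Function.iterate_succ_apply', ih (by omega), stepMinus]
    have e : lambdaK k * (sineRatio k (i + 1) * v.1 + sineRatio k (i + 2) * v.2)
        - (sineRatio k i * v.1 + sineRatio k (i + 1) * v.2)
        = sineRatio k (i + 1 + 1) * v.1 + sineRatio k (i + 1 + 2) * v.2 := by
      rw [sineRatio_add_two k (i + 1), show i + 1 + 1 = i + 2 from rfl, sineRatio_add_two k i]
      ring
    rw [e, abs_of_nonneg]
    exact add_nonneg (mul_nonneg (sineRatio_nonneg hk (by omega)) h1)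
      (mul_nonneg (sineRatio_nonneg hk (by omega)) h2)

/-- A sign `+` followed by `k - 1` signs `-` acts trivially. -/
lemma iterate_stepMinus_pred_stepPlus (hk : 3 ≤ k) (h1 : 0 ≤ v.1) (h2 : 0 ≤ v.2) :
    (stepMinus (lambdaK k))^[k - 1] (stepPlus (lambdaK k) v) = v := by
  obtain ⟨n, rfl⟩ : ∃ n, k = n + 2 := ⟨k - 2, by omega⟩
  have hp := sineRatio_pred hk
  have hs := sineRatio_self hk
  have hr := sineRatio_add_two (n + 2) n
  rw [show n + 2 - 1 = n + 1 from rfl] at *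
  rw [Function.iterate_succ_apply', iterate_stepMinus_stepPlus hk h1 h2 le_rfl, stepMinus]
  rw [hs, hp] at *
  have hn : sineRatio (n + 2) n = lambdaK (n + 2) := by linarith
  rw [hn]
  ext
  · simp
  · rw [show lambdaK (n + 2) * (1 * v.1 + 0 * v.2) - (lambdaK (n + 2) * v.1 + 1 * v.2) = -v.2 by
      ring, abs_neg, abs_of_nonneg h2]

end Walk

/-! ### The generating function of the means -/

section GeneratingFunction

/-- The variable `x = t D(t)`, in which the generating functions below are rational. -/
noncomputable def xSeries (k : ℕ) (p : ℝ) : PowerSeries ℝ :=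
  PowerSeries.X * treeSeries k (p * (1 - p) ^ (k - 1))

/-- `w = q t D(t)`: in `w ^ i`, the coefficient of `t ^ n` is the probability that the first `n`
signs, after cancellation of the blocks `+`, `-`, ..., `-`, leave `i` signs `-` and nothing else,
and that the `n`-th sign is the last of these. -/
noncomputable def wSeries (k : ℕ) (p : ℝ) : PowerSeries ℝ :=
  PowerSeries.C (1 - p) * xSeries k p

/-- `p x` times the sine polynomial at `w`. -/
noncomputable def sineSeries (k : ℕ) (p : ℝ) (s : ℕ) : PowerSeries ℝ :=
  PowerSeries.C p * xSeries k p * aeval (wSeries k p) (sinePoly k s)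

/-- The kernel `K(x(t))` of the renewal equation. -/
noncomputable def kernelSeries (k : ℕ) (p : ℝ) : PowerSeries ℝ :=
  aeval (xSeries k p) (kernelPoly k p)

/-- The renewal series `1 / (1 - K(x(t)))`. -/
noncomputable def renewalSeries (k : ℕ) (p : ℝ) : PowerSeries ℝ := (1 - kernelSeries k p)⁻¹

/-- The generating function of the expected values of the terms, restricted to the sequences of
signs for which, after cancellation, no sign `-` ever acts on the starting pair `v` itself. Along
these sequences no absolute value acts except in the cancellations, so it is linear in `v`. -/
noncomputable def keptSeries (k : ℕ) (p : ℝ) (v : ℝ × ℝ) : PowerSeries ℝ :=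
  treeSeries k (p * (1 - p) ^ (k - 1)) *
    (PowerSeries.C v.1 * (1 - sineSeries k p 2) + PowerSeries.C v.2 * sineSeries k p 1) *
      renewalSeries k p

/-- The sum, over the number `i < N` of signs `-` that are left uncancelled at the start, of the
contributions to the generating function of the means. -/
noncomputable def meanSeries (k : ℕ) (p : ℝ) (N : ℕ) (v : ℝ × ℝ) : PowerSeries ℝ :=
  ∑ i ∈ Finset.range N, wSeries k p ^ i * keptSeries k p ((stepMinus (lambdaK k))^[i] v)

variable {k : ℕ} {p : ℝ} {v : ℝ × ℝ}

lemma coeff_zero_xSeries (k : ℕ) (p : ℝ) : PowerSeries.coeff 0 (xSeries k p) = 0 := by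
  simp [xSeries]

lemma coeff_zero_wSeries (k : ℕ) (p : ℝ) : PowerSeries.coeff 0 (wSeries k p) = 0 := by
  simp [wSeries, xSeries]

lemma coeff_zero_sineSeries (k : ℕ) (p : ℝ) (s : ℕ) :
    PowerSeries.coeff 0 (sineSeries k p s) = 0 := by
  simp [sineSeries, xSeries]

lemma one_sub_kernelSeries (hk : 3 ≤ k) (p : ℝ) :
    1 - kernelSeries k p =
      (1 - sineSeries k p 0) * (1 - sineSeries k p 2) - sineSeries k p 1 ^ 2 :=
  one_sub_aeval_kernelPoly hk p (xSeries k p)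

lemma kernelSeries_eq (k : ℕ) (p : ℝ) :
    kernelSeries k p = PowerSeries.C (lambdaK k) * sineSeries k p 1 +
      PowerSeries.C p * xSeries k p * (sineSeries k p 1 +
        wSeries k p ^ (k - 1) * sineSeries k p 2) := by
  have := aeval_kernelPoly k p (xSeries k p)
  rw [kernelSeries, this]
  simp only [sineSeries, wSeries]
  simp only [show (algebraMap ℝ (PowerSeries ℝ)) = PowerSeries.C from rfl]
  ring

lemma coeff_zero_kernelSeries (k : ℕ) (p : ℝ) : PowerSeries.coeff 0 (kernelSeries k p) = 0 := by
  have h1 := coeff_zero_xSeries k p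
  have h2 := coeff_zero_sineSeries k p 1
  rw [PowerSeries.coeff_zero_eq_constantCoeff_apply] at *
  rw [kernelSeries_eq]
  simp [h1, h2]

lemma renewalSeries_mul (k : ℕ) (p : ℝ) : renewalSeries k p * (1 - kernelSeries k p) = 1 := by
  rw [renewalSeries, PowerSeries.inv_mul_cancel]
  have := coeff_zero_kernelSeries k p
  rw [PowerSeries.coeff_zero_eq_constantCoeff_apply] at this
  simp [this]

/-- First step decomposition: the first sign is `+`, and then at most `k - 1` signs `-` may be left
uncancelled relative to it, the last of which restores `v`. -/
lemma keptSeries_eq (hk : 3 ≤ k) (p : ℝ) (h1 : 0 ≤ v.1) (h2 : 0 ≤ v.2) :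
    keptSeries k p v = PowerSeries.C v.1 + PowerSeries.C p * PowerSeries.X *
      meanSeries k p k (stepPlus (lambdaK k) v) := by
  set a := PowerSeries.C v.1 with ha
  set b := PowerSeries.C v.2 with hb
  set D := treeSeries k (p * (1 - p) ^ (k - 1)) with hD
  set U := renewalSeries k p with hU
  set G := sineSeries k p 2 with hG
  set B := sineSeries k p 1 with hB
  set w := wSeries k p with hw
  have hUK : U * ((1 - sineSeries k p 0) * (1 - G) - B ^ 2) = 1 := by
    rw [← one_sub_kernelSeries hk, renewalSeries_mul]
  have hx : xSeries k p = PowerSeries.X * D := rfl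
  have hwx : w = PowerSeries.C (1 - p) * (PowerSeries.X * D) := rfl
  -- the terms `i < k - 1` are linear in `v`
  have hsum : PowerSeries.C p * (PowerSeries.X * D) * ∑ i ∈ Finset.range (k - 1),
      w ^ i * keptSeries k p ((stepMinus (lambdaK k))^[i] (stepPlus (lambdaK k) v))
      = D * U * ((a * sineSeries k p 0 + b * B) * (1 - G) + (a * B + b * G) * B) := by
    have hs : ∀ s, sineSeries k p s = PowerSeries.C p * (PowerSeries.X * D) *
        ∑ i ∈ Finset.range (k - 1), w ^ i * PowerSeries.C (sineRatio k (i + s)) := by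
      intro s
      rw [sineSeries, sinePoly, hx, map_sum]
      congr 1
      refine Finset.sum_congr rfl fun i _ => ?_
      rw [map_mul, map_pow, aeval_X, aeval_C, mul_comm]
      rfl
    have e1 : ∀ i ∈ Finset.range (k - 1),
        w ^ i * keptSeries k p ((stepMinus (lambdaK k))^[i] (stepPlus (lambdaK k) v))
        = D * U * ((a * (w ^ i * PowerSeries.C (sineRatio k (i + 0)))
            + b * (w ^ i * PowerSeries.C (sineRatio k (i + 1)))) * (1 - G)
          + (a * (w ^ i * PowerSeries.C (sineRatio k (i + 1)))
            + b * (w ^ i * PowerSeries.C (sineRatio k (i + 2)))) * B) := by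
      intro i hi
      rw [Finset.mem_range] at hi
      rw [iterate_stepMinus_stepPlus hk h1 h2 (by omega), keptSeries]
      simp only [map_add, map_mul, add_zero]
      ring
    rw [Finset.sum_congr rfl e1, ← Finset.mul_sum, Finset.sum_add_distrib, ← Finset.sum_mul,
      ← Finset.sum_mul, Finset.sum_add_distrib, Finset.sum_add_distrib, ← Finset.mul_sum,
      ← Finset.mul_sum, ← Finset.mul_sum, ← Finset.mul_sum]
    rw [hs 0]
    conv_rhs => rw [add_mul, add_mul]
    have e2 := hs 1
    have e3 := hs 2
    rw [← hB] at e2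
    rw [← hG] at e3
    set S0 := ∑ i ∈ Finset.range (k - 1), w ^ i * PowerSeries.C (sineRatio k (i + 0))
    set S1 := ∑ i ∈ Finset.range (k - 1), w ^ i * PowerSeries.C (sineRatio k (i + 1))
    set S2 := ∑ i ∈ Finset.range (k - 1), w ^ i * PowerSeries.C (sineRatio k (i + 2))
    linear_combination (-D * U * (b * (1 - G) + a * B)) * e2 - D * U * b * B * e3
  have hDeq : D = 1 + PowerSeries.C p * PowerSeries.X * w ^ (k - 1) * D := by
    have h := treeSeries_eq (by omega : 0 < k) (p * (1 - p) ^ (k - 1))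
    rw [← hD] at h
    have hk' : ∀ y : PowerSeries ℝ, y ^ k = y ^ (k - 1) * y := fun y => by
      rw [← pow_succ, Nat.sub_add_cancel (by omega)]
    rw [hk', hk', map_mul, map_pow] at h
    rw [hwx, mul_pow, mul_pow]
    linear_combination h
  have hF : keptSeries k p v = D * (a + PowerSeries.C p * PowerSeries.X *
      ∑ i ∈ Finset.range (k - 1),
        w ^ i * keptSeries k p ((stepMinus (lambdaK k))^[i] (stepPlus (lambdaK k) v))) := by
    rw [mul_add, show ∀ S : PowerSeries ℝ, D * (PowerSeries.C p * PowerSeries.X * S)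
      = PowerSeries.C p * (PowerSeries.X * D) * S from fun S => by ring, hsum, keptSeries]
    linear_combination (D * a) * hUK
  rw [meanSeries, show k = (k - 1) + 1 by omega, Finset.sum_range_succ,
    ← show k = (k - 1) + 1 by omega, iterate_stepMinus_pred_stepPlus hk h1 h2]
  set Y := a + PowerSeries.C p * PowerSeries.X * ∑ i ∈ Finset.range (k - 1),
        w ^ i * keptSeries k p ((stepMinus (lambdaK k))^[i] (stepPlus (lambdaK k) v))
  rw [mul_add, ← add_assoc]
  change keptSeries k p v = Y + _
  rw [hF]
  linear_combination Y * hDeq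

/-- First step decomposition of the truncated generating functions. A sign `+` makes room for
`k - 1` more signs `-`, whence the truncation at `k + N`. -/
lemma meanSeries_succ (hk : 3 ≤ k) (p : ℝ) (h1 : 0 ≤ v.1) (h2 : 0 ≤ v.2) (N : ℕ) :
    meanSeries k p (N + 1) v = PowerSeries.C v.1
      + PowerSeries.C p * PowerSeries.X * meanSeries k p (k + N) (stepPlus (lambdaK k) v)
      + PowerSeries.C (1 - p) * PowerSeries.X * meanSeries k p N (stepMinus (lambdaK k) v) := by
  have e1 : meanSeries k p (N + 1) v
      = keptSeries k p v + wSeries k p * meanSeries k p N (stepMinus (lambdaK k) v) := by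
    rw [meanSeries, Finset.sum_range_succ', add_comm, meanSeries, Finset.mul_sum]
    congr 1
    · simp
    · refine Finset.sum_congr rfl fun i _ => ?_
      rw [Function.iterate_succ_apply, pow_succ']
      ring
  have e2 : meanSeries k p (k + N) (stepPlus (lambdaK k) v)
      = meanSeries k p k (stepPlus (lambdaK k) v)
        + wSeries k p ^ k * meanSeries k p N (stepMinus (lambdaK k) v) := by
    rw [meanSeries, Finset.sum_range_add, meanSeries, meanSeries, Finset.mul_sum]
    congr 1
    refine Finset.sum_congr rfl fun i _ => ?_
    have : (stepMinus (lambdaK k))^[k + i] (stepPlus (lambdaK k) v)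
        = (stepMinus (lambdaK k))^[i] (stepMinus (lambdaK k) v) := by
      rw [show k + i = i + 1 + (k - 1) by omega, Function.iterate_add_apply,
        iterate_stepMinus_pred_stepPlus hk h1 h2, Function.iterate_succ_apply]
    rw [this, pow_add, mul_assoc]
  have hw : wSeries k p = PowerSeries.C (1 - p) * PowerSeries.X
      + PowerSeries.C p * PowerSeries.X * wSeries k p ^ k := by
    have h := treeSeries_eq (by omega : 0 < k) (p * (1 - p) ^ (k - 1))
    have hC : PowerSeries.C (1 - p) ^ k = PowerSeries.C (1 - p) ^ (k - 1) * PowerSeries.C (1 - p)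
        := by rw [← pow_succ, Nat.sub_add_cancel (by omega)]
    rw [map_mul, map_pow] at h
    unfold wSeries xSeries
    rw [mul_pow, mul_pow, hC]
    linear_combination (PowerSeries.C (1 - p) * PowerSeries.X) * h
  rw [e1, e2, keptSeries_eq hk p h1 h2]
  linear_combination meanSeries k p N (stepMinus (lambdaK k) v) * hw

/-- The truncated generating functions compute the means. -/
theorem meanFun_eq_coeff (hk : 3 ≤ k) (p : ℝ) (n : ℕ) {v : ℝ × ℝ} (h1 : 0 ≤ v.1) (h2 : 0 ≤ v.2)
    {N : ℕ} (hN : n < N) :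
    meanFun (lambdaK k) p n v = PowerSeries.coeff n (meanSeries k p N v) := by
  induction n generalizing v N with
  | zero =>
    obtain ⟨N, rfl⟩ : ∃ M, N = M + 1 := ⟨N - 1, by omega⟩
    rw [meanSeries_succ hk p h1 h2]
    simp [meanFun]
  | succ n ih =>
    obtain ⟨N, rfl⟩ : ∃ M, N = M + 1 := ⟨N - 1, by omega⟩
    rw [meanSeries_succ hk p h1 h2, meanFun,
      ih (v := stepPlus (lambdaK k) v) h2 (abs_nonneg _) (N := k + N) (by omega),
      ih (v := stepMinus (lambdaK k) v) h2 (abs_nonneg _) (N := N) (by omega)]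
    simp only [map_add, mul_assoc, PowerSeries.coeff_C_mul, PowerSeries.coeff_succ_X_mul,
      PowerSeries.coeff_C, if_neg (Nat.succ_ne_zero n), zero_add]

end GeneratingFunction

/-! ### Asymptotics of the means -/

section Asymptotics

variable {k : ℕ} {p t s : ℝ} {v : ℝ × ℝ}

lemma excursionWeight_nonneg (hp0 : 0 ≤ p) (hp1 : p ≤ 1) (k : ℕ) : 0 ≤ p * (1 - p) ^ (k - 1) :=
  mul_nonneg hp0 (pow_nonneg (sub_nonneg.2 hp1) _)

lemma nonnegCoeff_xSeries (hp0 : 0 ≤ p) (hp1 : p ≤ 1) : NonnegCoeff (xSeries k p) :=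
  NonnegCoeff.X.mul (nonnegCoeff_treeSeries (excursionWeight_nonneg hp0 hp1 k))

lemma nonnegCoeff_wSeries (hp0 : 0 ≤ p) (hp1 : p ≤ 1) : NonnegCoeff (wSeries k p) :=
  (NonnegCoeff.C (sub_nonneg.2 hp1)).mul (nonnegCoeff_xSeries hp0 hp1)

lemma nonnegCoeff_sineSeries (hk : 3 ≤ k) (hp0 : 0 ≤ p) (hp1 : p ≤ 1) {j : ℕ} (hj : j ≤ 2) :
    NonnegCoeff (sineSeries k p j) :=
  ((NonnegCoeff.C hp0).mul (nonnegCoeff_xSeries hp0 hp1)).mul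
    (NonnegCoeff.aeval (coeff_sinePoly_nonneg hk hj) (nonnegCoeff_wSeries hp0 hp1))

lemma nonnegCoeff_kernelSeries (hk : 3 ≤ k) (hp0 : 0 ≤ p) (hp1 : p ≤ 1) :
    NonnegCoeff (kernelSeries k p) := by
  have hl : 0 ≤ lambdaK k := zero_le_one.trans (one_le_lambdaK hk)
  have h1 := nonnegCoeff_sineSeries hk hp0 hp1 one_le_two
  have h2 := nonnegCoeff_sineSeries hk hp0 hp1 le_rfl
  rw [kernelSeries_eq]
  exact ((NonnegCoeff.C hl).mul h1).add
    (((NonnegCoeff.C hp0).mul (nonnegCoeff_xSeries hp0 hp1)).mul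
      (h1.add (((nonnegCoeff_wSeries hp0 hp1).pow _).mul h2)))

lemma coeff_one_kernelSeries_pos (hk : 3 ≤ k) (hp0 : 0 < p) (hp1 : p ≤ 1) :
    0 < PowerSeries.coeff 1 (kernelSeries k p) := by
  have hl : 0 < lambdaK k := zero_lt_one.trans_le (one_le_lambdaK hk)
  have h1 := nonnegCoeff_sineSeries hk hp0.le hp1 one_le_two
  have h2 := nonnegCoeff_sineSeries hk hp0.le hp1 le_rfl
  rw [kernelSeries_eq, map_add]
  refine add_pos_of_pos_of_nonneg ?_ ((((NonnegCoeff.C hp0.le).mul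
    (nonnegCoeff_xSeries hp0.le hp1)).mul
      (h1.add (((nonnegCoeff_wSeries hp0.le hp1).pow _).mul h2))) 1)
  rw [PowerSeries.coeff_C_mul]
  refine mul_pos hl ?_
  rw [sineSeries, xSeries, mul_assoc, PowerSeries.coeff_C_mul, mul_assoc]
  refine mul_pos hp0 ?_
  have h3 := coeff_zero_treeSeries (by omega : 0 < k) (p * (1 - p) ^ (k - 1))
  have h4 := coeff_zero_wSeries k p
  rw [show (1 : ℕ) = 0 + 1 from rfl, PowerSeries.coeff_succ_X_mul]
  rw [PowerSeries.coeff_zero_eq_constantCoeff_apply] at *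
  rw [map_mul, h3, one_mul, aeval_def, hom_eval₂, h4]
  have h5 : PowerSeries.constantCoeff.comp (algebraMap ℝ (PowerSeries ℝ)) = RingHom.id ℝ := by
    ext r
    exact PowerSeries.constantCoeff_C r
  rw [h5, eval₂_id]
  exact zero_lt_one.trans_le (one_le_eval_sinePoly_one hk le_rfl)

lemma absHasSum_xSeries (hD : AbsHasSum (treeSeries k (p * (1 - p) ^ (k - 1))) t s) :
    AbsHasSum (xSeries k p) t (t * s) := (AbsHasSum.X t).mul hD

lemma absHasSum_wSeries (hD : AbsHasSum (treeSeries k (p * (1 - p) ^ (k - 1))) t s) :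
    AbsHasSum (wSeries k p) t ((1 - p) * (t * s)) :=
  (AbsHasSum.C _ t).mul (absHasSum_xSeries hD)

lemma absHasSum_sineSeries (hD : AbsHasSum (treeSeries k (p * (1 - p) ^ (k - 1))) t s)
    (j : ℕ) : AbsHasSum (sineSeries k p j) t
    (p * (t * s) * (sinePoly k j).eval ((1 - p) * (t * s))) :=
  ((AbsHasSum.C p t).mul (absHasSum_xSeries hD)).mul ((absHasSum_wSeries hD).aeval _)

lemma absHasSum_kernelSeries (hD : AbsHasSum (treeSeries k (p * (1 - p) ^ (k - 1))) t s) :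
    AbsHasSum (kernelSeries k p) t ((kernelPoly k p).eval (t * s)) :=
  (absHasSum_xSeries hD).aeval _

/-- `keptSeries` is the product of a convergent series and the renewal series. -/
lemma absHasSum_keptSeries_factor (hD : AbsHasSum (treeSeries k (p * (1 - p) ^ (k - 1))) t s)
    (v : ℝ × ℝ) :
    AbsHasSum (treeSeries k (p * (1 - p) ^ (k - 1)) *
      (PowerSeries.C v.1 * (1 - sineSeries k p 2) + PowerSeries.C v.2 * sineSeries k p 1)) t
      (s * (v.1 * (1 - p * (t * s) * (sinePoly k 2).eval ((1 - p) * (t * s)))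
        + v.2 * (p * (t * s) * (sinePoly k 1).eval ((1 - p) * (t * s))))) :=
  hD.mul (((AbsHasSum.C _ t).mul ((AbsHasSum.one t).sub (absHasSum_sineSeries hD 2))).add
    ((AbsHasSum.C _ t).mul (absHasSum_sineSeries hD 1)))

/-- If the scaled coefficients of the renewal series are bounded, so are those of `keptSeries`,
uniformly for bounded starting pairs. -/
lemma keptSeries_bounded {B : ℝ} (hD : AbsHasSum (treeSeries k (p * (1 - p) ^ (k - 1))) t s)
    (hU : ∀ n, |PowerSeries.coeff n (renewalSeries k p) * t ^ n| ≤ 1) :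
    ∃ M, 0 ≤ M ∧ ∀ v : ℝ × ℝ, |v.1| ≤ B → |v.2| ≤ B → ∀ n,
      |PowerSeries.coeff n (keptSeries k p v) * t ^ n| ≤ M := by
  have e : ∀ v : ℝ × ℝ, keptSeries k p v
      = PowerSeries.C v.1 * keptSeries k p (1, 0) + PowerSeries.C v.2 * keptSeries k p (0, 1) := by
    intro v
    simp only [keptSeries, map_one, map_zero]
    ring
  have h1 := (absHasSum_keptSeries_factor hD (1, 0)).abs_coeff_mul_le hU
  have h2 := (absHasSum_keptSeries_factor hD (0, 1)).abs_coeff_mul_le hU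
  set M1 := ∑' j, |PowerSeries.coeff j (treeSeries k (p * (1 - p) ^ (k - 1)) *
      (PowerSeries.C (1, 0).1 * (1 - sineSeries k p 2) + PowerSeries.C (1, 0).2 * sineSeries k p 1))
        * t ^ j|
  set M2 := ∑' j, |PowerSeries.coeff j (treeSeries k (p * (1 - p) ^ (k - 1)) *
      (PowerSeries.C (0, 1).1 * (1 - sineSeries k p 2) + PowerSeries.C (0, 1).2 * sineSeries k p 1))
        * t ^ j|
  have hM1 : 0 ≤ M1 := tsum_nonneg fun _ => abs_nonneg _
  have hM2 : 0 ≤ M2 := tsum_nonneg fun _ => abs_nonneg _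
  refine ⟨|B| * (M1 * 1) + |B| * (M2 * 1), by positivity, fun v hv1 hv2 n => ?_⟩
  rw [e, map_add, PowerSeries.coeff_C_mul, PowerSeries.coeff_C_mul, add_mul, mul_assoc, mul_assoc]
  refine (abs_add_le _ _).trans (add_le_add ?_ ?_)
  · rw [abs_mul]
    exact mul_le_mul (hv1.trans (le_abs_self B)) (h1 n) (abs_nonneg _) (abs_nonneg _)
  · rw [abs_mul]
    exact mul_le_mul (hv2.trans (le_abs_self B)) (h2 n) (abs_nonneg _) (abs_nonneg _)

lemma iterate_stepMinus_abs_bounded (hk : 3 ≤ k) (h1 : 0 ≤ v.1) (h2 : 0 ≤ v.2) :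
    ∃ B, ∀ i, |((stepMinus (lambdaK k))^[i] v).1| ≤ B ∧
      |((stepMinus (lambdaK k))^[i] v).2| ≤ B := by
  obtain ⟨B, hB⟩ := iterate_stepMinus_bounded (zero_le_one.trans (one_le_lambdaK hk))
    (lambdaK_lt_two hk) h1 h2
  refine ⟨B, fun i => ?_⟩
  obtain ⟨n1, n2⟩ := iterate_stepMinus_nonneg (lam := lambdaK k) h1 h2 i
  rw [abs_of_nonneg n1, abs_of_nonneg n2]
  exact hB i

lemma meanFun_mul_pow (hk : 3 ≤ k) (p t : ℝ) (n : ℕ) (h1 : 0 ≤ v.1) (h2 : 0 ≤ v.2) :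
    meanFun (lambdaK k) p n v * t ^ n = ∑ i ∈ Finset.range (n + 1), PowerSeries.coeff n
      (wSeries k p ^ i * keptSeries k p ((stepMinus (lambdaK k))^[i] v)) * t ^ n := by
  rw [meanFun_eq_coeff hk p n h1 h2 (Nat.lt_succ_self n), meanSeries, map_sum, Finset.sum_mul]

lemma abs_coeff_renewalSeries_le (hk : 3 ≤ k) (hp0 : 0 ≤ p) (hp1 : p ≤ 1) (ht : 0 ≤ t)
    (hD : AbsHasSum (treeSeries k (p * (1 - p) ^ (k - 1))) t s)
    (hK : (kernelPoly k p).eval (t * s) ≤ 1) (n : ℕ) :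
    |PowerSeries.coeff n (renewalSeries k p) * t ^ n| ≤ 1 := by
  have := coeff_inverse_mem_Icc (nonnegCoeff_kernelSeries hk hp0 hp1) (coeff_zero_kernelSeries k p)
    ht (absHasSum_kernelSeries hD) hK (renewalSeries_mul k p) n
  exact abs_le.2 ⟨by linarith [this.1], this.2⟩

/-- The exact exponential order of the means, at a point `t` where the kernel takes the value `1`,
`w` is less than `1` and which lies inside the disc of convergence. -/
theorem meanFun_tendsto (hk : 3 ≤ k) (hp0 : 0 < p) (hp1 : p ≤ 1) {t' s' : ℝ} (ht : 0 < t)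
    (htt' : t < t') (hs : 0 < s)
    (hD : AbsHasSum (treeSeries k (p * (1 - p) ^ (k - 1))) t s)
    (hD' : AbsHasSum (treeSeries k (p * (1 - p) ^ (k - 1))) t' s')
    (hK : (kernelPoly k p).eval (t * s) = 1) (hw : (1 - p) * (t * s) < 1)
    (h1 : 0 ≤ v.1) (h2 : 0 < v.2) :
    ∃ L, 0 < L ∧ Tendsto (fun n => meanFun (lambdaK k) p n v * t ^ n) atTop (𝓝 L) := by
  have hq : 0 ≤ 1 - p := sub_nonneg.2 hp1
  have hx : 0 < t * s := mul_pos ht hs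
  have hw0 : 0 ≤ (1 - p) * (t * s) := mul_nonneg hq hx.le
  have hKn := nonnegCoeff_kernelSeries (k := k) hk hp0.le hp1
  have hKs := absHasSum_kernelSeries hD
  have hU1 := abs_coeff_renewalSeries_le hk hp0.le hp1 ht.le hD hK.le
  -- the renewal theorem, with the finite mean coming from convergence at `t' > t`
  have hmean : Summable fun n : ℕ => n * (PowerSeries.coeff n (kernelSeries k p) * t ^ n) := by
    have ht' : 0 < t' := ht.trans htt'
    obtain ⟨B, hB⟩ := (Metric.isBounded_range_of_tendsto _
      (tendsto_self_mul_const_pow_of_lt_one (div_nonneg ht.le ht'.le)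
        ((div_lt_one ht').2 htt'))).exists_norm_le
    refine Summable.of_norm_bounded ((absHasSum_kernelSeries hD').1.mul_right B) fun n => ?_
    have e : (n : ℝ) * (PowerSeries.coeff n (kernelSeries k p) * t ^ n)
        = (PowerSeries.coeff n (kernelSeries k p) * t' ^ n) * (n * (t / t') ^ n) := by
      rw [div_pow]
      field_simp
    rw [e, norm_mul]
    exact mul_le_mul_of_nonneg_left (hB _ ⟨n, rfl⟩) (norm_nonneg _)
  obtain ⟨l, hl, hUl⟩ := renewal_tendsto
    (fun n => mul_nonneg (hKn n) (pow_nonneg ht.le n)) (by simp [coeff_zero_kernelSeries])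
    (mul_pos (coeff_one_kernelSeries_pos hk hp0 hp1) (pow_pos ht 1)) (hK ▸ hKs.2) hmean
    (scaled_renewal_eq (renewalSeries_mul k p) t)
  -- the limit of each term of the sum over the number of uncancelled signs `-`
  set G := p * (t * s) * (sinePoly k 2).eval ((1 - p) * (t * s)) with hG
  set B := p * (t * s) * (sinePoly k 1).eval ((1 - p) * (t * s)) with hB
  have hBpos : 0 < B := mul_pos (mul_pos hp0 hx)
    (zero_lt_one.trans_le (one_le_eval_sinePoly_one hk hw0))
  have hG1 : G ≤ 1 := by
    have e := congrArg (eval ((1 - p) * (t * s))) (sinePoly_zero_add_two k)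
    rw [eval_add, eval_mul, eval_C] at e
    have n0 := eval_nonneg_of_coeff_nonneg (coeff_sinePoly_nonneg hk zero_le_two) hw0
    have n1 := eval_nonneg_of_coeff_nonneg (coeff_sinePoly_nonneg hk one_le_two) hw0
    have n2 := eval_nonneg_of_coeff_nonneg (coeff_sinePoly_nonneg hk le_rfl) hw0
    rw [← hK, eval_kernelPoly, mul_assoc (lambdaK k), mul_left_comm, ← e, mul_add]
    have : 0 ≤ (p * (t * s)) ^ 2 * ((sinePoly k 1).eval ((1 - p) * (t * s)) +
        ((1 - p) * (t * s)) ^ (k - 1) * (sinePoly k 2).eval ((1 - p) * (t * s))) := by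
      positivity
    have := mul_nonneg (mul_nonneg hp0.le hx.le) n0
    linarith
  obtain ⟨Bd, hBd⟩ := iterate_stepMinus_abs_bounded hk h1 h2.le
  obtain ⟨M, hM0, hM⟩ := keptSeries_bounded hD (B := Bd) hU1
  set z : ℕ → ℝ × ℝ := fun i => (stepMinus (lambdaK k))^[i] v with hz
  set c : ℕ → ℝ := fun i => ((1 - p) * (t * s)) ^ i *
    (s * ((z i).1 * (1 - G) + (z i).2 * B) * l) with hc
  have hwn := nonnegCoeff_wSeries (k := k) hp0.le hp1
  have hterm : ∀ i, Tendsto (fun n => PowerSeries.coeff n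
      (wSeries k p ^ i * keptSeries k p (z i)) * t ^ n) atTop (𝓝 (c i)) := fun i =>
    ((absHasSum_wSeries hD).pow i).tendsto_coeff_mul
      ((absHasSum_keptSeries_factor hD (z i)).tendsto_coeff_mul hUl)
  have hbound : ∀ i n, |PowerSeries.coeff n
      (wSeries k p ^ i * keptSeries k p (z i)) * t ^ n| ≤ ((1 - p) * (t * s)) ^ i * M := fun i n =>
    ((absHasSum_wSeries hD).pow i).abs_coeff_mul_le_of_nonneg (hwn.pow i) ht.le
      (hM (z i) (hBd i).1 (hBd i).2) n
  have hgeom : Summable fun i => ((1 - p) * (t * s)) ^ i * M :=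
    (summable_geometric_of_lt_one hw0 hw).mul_right M
  have hc0 : ∀ i, 0 ≤ c i := fun i => by
    obtain ⟨n1, n2⟩ := iterate_stepMinus_nonneg (lam := lambdaK k) h1 h2.le i
    have := sub_nonneg.2 hG1
    simp only [hc]
    positivity
  have hcs : Summable c := Summable.of_nonneg_of_le hc0 (fun i =>
    le_of_tendsto (hterm i) (Eventually.of_forall fun n => (le_abs_self _).trans (hbound i n)))
    hgeom
  refine ⟨∑' i, c i, hcs.tsum_pos hc0 0 ?_, ?_⟩
  · have := sub_nonneg.2 hG1
    simp only [hc, hz, pow_zero, one_mul, Function.iterate_zero, id]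
    positivity
  · have e : ∀ n, meanFun (lambdaK k) p n v * t ^ n = ∑' i, if i ≤ n then PowerSeries.coeff n
        (wSeries k p ^ i * keptSeries k p (z i)) * t ^ n else 0 := by
      intro n
      rw [meanFun_mul_pow hk p t n h1 h2.le, tsum_eq_sum (s := Finset.range (n + 1))]
      · refine Finset.sum_congr rfl fun i hi => ?_
        rw [if_pos (Nat.lt_succ_iff.1 (Finset.mem_range.1 hi))]
      · intro i hi
        rw [if_neg]
        simpa [Nat.lt_succ_iff] using hi
    simp_rw [e]
    refine tendsto_tsum_of_dominated_convergence hgeom (fun i => ?_)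
      (Eventually.of_forall fun n i => ?_)
    · refine (hterm i).congr' ?_
      filter_upwards [eventually_ge_atTop i] with n hn
      rw [if_pos hn]
    · split_ifs
      · exact hbound i n
      · simpa using mul_nonneg (pow_nonneg hw0 i) hM0

lemma criticalP_le (hk : 3 ≤ k) : criticalP k ≤ 1 / 4 := by
  unfold criticalP
  linarith [one_le_lambdaK hk]

lemma criticalP_pos (hk : 3 ≤ k) : 0 < criticalP k := by
  unfold criticalP
  linarith [lambdaK_lt_two hk]

/-- At `t = 1`, the point `x = 1 / q` solves the fixed point equation. -/
lemma exists_absHasSum_treeSeries_one (hk : 3 ≤ k) (hp0 : 0 ≤ p) (hp1 : p < 1) :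
    ∃ s, AbsHasSum (treeSeries k (p * (1 - p) ^ (k - 1))) 1 s ∧ 1 ≤ s ∧ s ≤ (1 - p)⁻¹ := by
  have hq : 0 < 1 - p := sub_pos.2 hp1
  obtain ⟨s, hs, hsy, hs1, -⟩ := exists_absHasSum_treeSeries (t := 1) (y := (1 - p)⁻¹)
    (by omega : 0 < k) (excursionWeight_nonneg hp0 hp1.le k) zero_le_one (by positivity) (by
      obtain ⟨n, rfl⟩ : ∃ n, k = n + 1 := ⟨k - 1, by omega⟩
      rw [Nat.add_sub_cancel, one_pow, mul_one, inv_pow, pow_succ]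
      apply le_of_eq
      field_simp
      ring)
  exact ⟨s, hs, hs1, hsy⟩

lemma eval_kernelPoly_inv_le_one_iff (hk : 3 ≤ k) (hp1 : p < 1) :
    (kernelPoly k p).eval (1 - p)⁻¹ ≤ 1 ↔ p ≤ criticalP k := by
  have hq : 0 < (1 - p) ^ 2 := pow_pos (sub_pos.2 hp1) 2
  rw [← not_lt, one_lt_eval_kernelPoly_iff hk, deltaFun_inv hk hp1, not_lt, le_div_iff₀ hq,
    zero_mul]
  constructor <;> intro <;> linarith

/-- Linear growth at and below the critical value. -/
theorem meanFun_linear_bound (hk : 3 ≤ k) (hp0 : 0 ≤ p) (hp : p ≤ criticalP k)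
    (h1 : 0 ≤ v.1) (h2 : 0 ≤ v.2) :
    ∃ M, ∀ n : ℕ, |meanFun (lambdaK k) p n v| ≤ M * (n + 1) := by
  have hp1 : p < 1 := by linarith [criticalP_le hk]
  have hq : 0 < 1 - p := sub_pos.2 hp1
  obtain ⟨s, hD, hs1, hsq⟩ := exists_absHasSum_treeSeries_one hk hp0 hp1
  have hK : (kernelPoly k p).eval (1 * s) ≤ 1 := by
    rw [one_mul]
    exact (kernelPoly_mono hk hp0 hp1.le (by linarith) hsq).trans
      ((eval_kernelPoly_inv_le_one_iff hk hp1).2 hp)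
  obtain ⟨Bd, hBd⟩ := iterate_stepMinus_abs_bounded hk h1 h2
  obtain ⟨M, hM0, hM⟩ := keptSeries_bounded hD (B := Bd)
    (abs_coeff_renewalSeries_le hk hp0 hp1.le zero_le_one hD hK)
  have hw1 : (1 - p) * (1 * s) ≤ 1 := by
    rw [one_mul]
    calc (1 - p) * s ≤ (1 - p) * (1 - p)⁻¹ := by gcongr
      _ = 1 := mul_inv_cancel₀ hq.ne'
  refine ⟨M, fun n => ?_⟩
  have e := meanFun_mul_pow hk p 1 n h1 h2
  rw [one_pow, mul_one] at e
  rw [e]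
  have hb : ∀ i ∈ Finset.range (n + 1), |PowerSeries.coeff n
      (wSeries k p ^ i * keptSeries k p ((stepMinus (lambdaK k))^[i] v)) * 1| ≤ M := by
    intro i _
    have := ((absHasSum_wSeries hD).pow i).abs_coeff_mul_le_of_nonneg
      ((nonnegCoeff_wSeries hp0 hp1.le).pow i) zero_le_one (hM _ (hBd i).1 (hBd i).2) n
    rw [one_pow] at this
    refine this.trans (mul_le_of_le_one_left hM0 (pow_le_one₀ (by positivity) hw1))
  refine (Finset.abs_sum_le_sum_abs _ _).trans ((Finset.sum_le_card_nsmul _ _ _ hb).trans ?_)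
  rw [Finset.card_range, nsmul_eq_mul, mul_comm]
  push_cast
  exact le_rfl

/-- The coefficients of `∑ i < N, w ^ i` are at most those of the renewal series `1 / (1 - w)`. -/
lemma coeff_geom_sum_wSeries_le (hp0 : 0 ≤ p) (hp1 : p ≤ 1)
    (hD : AbsHasSum (treeSeries k (p * (1 - p) ^ (k - 1))) 1 s) (hw : (1 - p) * (1 * s) ≤ 1)
    (N n : ℕ) : PowerSeries.coeff n (∑ i ∈ Finset.range N, wSeries k p ^ i) ≤ 1 := by
  have hwn := nonnegCoeff_wSeries (k := k) hp0 hp1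
  have hw0 := coeff_zero_wSeries k p
  set V := (1 - wSeries k p)⁻¹ with hV
  have hVw : V * (1 - wSeries k p) = 1 := by
    rw [hV, PowerSeries.inv_mul_cancel]
    rw [PowerSeries.coeff_zero_eq_constantCoeff_apply] at hw0
    simp [hw0]
  have hV01 := coeff_inverse_mem_Icc hwn hw0 zero_le_one (absHasSum_wSeries hD) hw hVw
  simp only [one_pow, mul_one] at hV01
  have e : ∑ i ∈ Finset.range N, wSeries k p ^ i = V - wSeries k p ^ N * V := by
    linear_combination V * geom_sum_mul_neg (wSeries k p) N
      - (∑ i ∈ Finset.range N, wSeries k p ^ i) * hVw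
  rw [e, map_sub]
  have hVn : NonnegCoeff V := fun n => (hV01 n).1
  linarith [(hV01 n).2, (hwn.pow N).mul hVn n]

/-- Boundedness below the critical value: the coefficients of `keptSeries` are summable. -/
theorem meanFun_bounded (hk : 3 ≤ k) (hp0 : 0 ≤ p) (hp : p < criticalP k)
    (h1 : 0 ≤ v.1) (h2 : 0 ≤ v.2) :
    ∃ M, ∀ n : ℕ, |meanFun (lambdaK k) p n v| ≤ M := by
  have hp1 : p < 1 := by linarith [criticalP_le hk]
  have hq : 0 < 1 - p := sub_pos.2 hp1
  obtain ⟨s, hD, hs1, hsq⟩ := exists_absHasSum_treeSeries_one hk hp0 hp1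
  have hKinv : (kernelPoly k p).eval (1 - p)⁻¹ < 1 := by
    rw [← sub_pos, ← mul_pos_iff_of_pos_left (charPoly_pos hk ((1 - p) * (1 - p)⁻¹)),
      charPoly_mul_one_sub_kernelPoly hk, deltaFun_inv hk hp1]
    have := sub_pos.2 hp
    positivity
  have hK : (kernelPoly k p).eval (1 * s) < 1 := by
    rw [one_mul]
    exact (kernelPoly_mono hk hp0 hp1.le (by linarith) hsq).trans_lt hKinv
  have hw1 : (1 - p) * (1 * s) ≤ 1 := by
    rw [one_mul]
    calc (1 - p) * s ≤ (1 - p) * (1 - p)⁻¹ := by gcongr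
      _ = 1 := mul_inv_cancel₀ hq.ne'
  obtain ⟨r, hU⟩ := AbsHasSum.inverse (nonnegCoeff_kernelSeries hk hp0 hp1.le)
    (coeff_zero_kernelSeries k p) zero_le_one (absHasSum_kernelSeries hD) hK
    (renewalSeries_mul k p)
  have hF := fun v => (absHasSum_keptSeries_factor hD v).mul hU
  obtain ⟨Bd, hBd⟩ := iterate_stepMinus_abs_bounded hk h1 h2
  have hBd0 : 0 ≤ Bd := (abs_nonneg _).trans (hBd 0).1
  -- a summable majorant of the coefficients, uniform in the number of signs `-`
  set Φ : ℕ → ℝ := fun n => Bd * (|PowerSeries.coeff n (keptSeries k p (1, 0)) * 1 ^ n|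
    + |PowerSeries.coeff n (keptSeries k p (0, 1)) * 1 ^ n|) with hΦ
  have hΦs : Summable Φ := ((hF (1, 0)).1.add (hF (0, 1)).1).mul_left Bd
  have hΦ0 : ∀ n, 0 ≤ Φ n := fun n => by simp only [hΦ]; positivity
  have hle : ∀ i n, |PowerSeries.coeff n (keptSeries k p ((stepMinus (lambdaK k))^[i] v))|
      ≤ Φ n := by
    intro i n
    set z := (stepMinus (lambdaK k))^[i] v with hz
    have e : keptSeries k p z
      = PowerSeries.C z.1 * keptSeries k p (1, 0) + PowerSeries.C z.2 * keptSeries k p (0, 1) := by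
      simp only [keptSeries, map_one, map_zero]
      ring
    rw [e, map_add, PowerSeries.coeff_C_mul, PowerSeries.coeff_C_mul]
    simp only [hΦ, one_pow, mul_one, mul_add]
    refine (abs_add_le _ _).trans (add_le_add ?_ ?_)
    · rw [abs_mul]
      exact mul_le_mul_of_nonneg_right (hBd i).1 (abs_nonneg _)
    · rw [abs_mul]
      exact mul_le_mul_of_nonneg_right (hBd i).2 (abs_nonneg _)
  have hwn := nonnegCoeff_wSeries (k := k) hp0 hp1.le
  refine ⟨∑' n, Φ n, fun n => ?_⟩
  have e := meanFun_mul_pow hk p 1 n h1 h2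
  simp only [one_pow, mul_one] at e
  rw [e]
  calc |∑ i ∈ Finset.range (n + 1), PowerSeries.coeff n
        (wSeries k p ^ i * keptSeries k p ((stepMinus (lambdaK k))^[i] v))|
      ≤ ∑ i ∈ Finset.range (n + 1), ∑ ij ∈ antidiagonal n,
          PowerSeries.coeff ij.1 (wSeries k p ^ i) * Φ ij.2 := by
        refine (Finset.abs_sum_le_sum_abs _ _).trans (Finset.sum_le_sum fun i _ => ?_)
        rw [PowerSeries.coeff_mul]
        refine (Finset.abs_sum_le_sum_abs _ _).trans (Finset.sum_le_sum fun ij _ => ?_)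
        rw [abs_mul, abs_of_nonneg (hwn.pow i _)]
        exact mul_le_mul_of_nonneg_left (hle i _) (hwn.pow i _)
    _ = ∑ ij ∈ antidiagonal n,
          PowerSeries.coeff ij.1 (∑ i ∈ Finset.range (n + 1), wSeries k p ^ i) * Φ ij.2 := by
        rw [Finset.sum_comm]
        refine Finset.sum_congr rfl fun ij _ => ?_
        rw [map_sum, Finset.sum_mul]
    _ ≤ ∑ ij ∈ antidiagonal n, Φ ij.2 := Finset.sum_le_sum fun ij _ =>
        mul_le_of_le_one_left (hΦ0 _) (coeff_geom_sum_wSeries_le hp0 hp1.le hD hw1 _ _)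
    _ = ∑ j ∈ Finset.range (n + 1), Φ j := by
        rw [← Finset.Nat.sum_antidiagonal_swap,
          Finset.Nat.sum_antidiagonal_eq_sum_range_succ_mk]
        rfl
    _ ≤ ∑' n, Φ n := hΦs.sum_le_tsum _ fun i _ => hΦ0 i

end Asymptotics

/-! ### The means of a random Fibonacci sequence -/

section Probability

/-- The pair of consecutive terms reached from `v` with the first `n` of the given signs. -/
def walk (lam : ℝ) (v : ℝ × ℝ) (e : ℕ → Bool) : ℕ → ℝ × ℝ
  | 0 => v
  | n + 1 => if e n = true then stepPlus lam (walk lam v e n) else stepMinus lam (walk lam v e n)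

lemma walk_congr (lam : ℝ) (v : ℝ × ℝ) {e e' : ℕ → Bool} {n : ℕ} (h : ∀ i < n, e i = e' i) :
    walk lam v e n = walk lam v e' n := by
  induction n with
  | zero => rfl
  | succ n ih =>
    rw [walk, walk, ih fun i hi => h i (hi.trans n.lt_succ_self), h n n.lt_succ_self]

/-- A function of finitely many of the signs, as a function on a finite type. -/
lemma walk_eq_comp {Ω : Type*} (lam : ℝ) (v : ℝ × ℝ) (ε : ℕ → Ω → Bool) (n : ℕ) (ω : Ω) :
    walk lam v (fun i => ε i ω) n
      = walk lam v (fun i => if h : i ∈ Finset.range n then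
          (fun j : Finset.range n => ε j ω) ⟨i, h⟩ else false) n := by
  refine walk_congr lam v fun i hi => ?_
  rw [dif_pos (Finset.mem_range.2 hi)]

variable {Ω : Type*} [MeasurableSpace Ω] {μ : Measure Ω} {p : ℝ} {ε : ℕ → Ω → Bool}

lemma integrable_comp_walk [IsProbabilityMeasure μ]
    (hε : IsCoinTossing μ p ε) (lam : ℝ) (v : ℝ × ℝ) (n : ℕ)
    (h : ℝ × ℝ → ℝ) : Integrable (fun ω => h (walk lam v (fun i => ε i ω) n)) μ := by
  simp_rw [walk_eq_comp lam v ε n]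
  set Ψ : (Finset.range n → Bool) → ℝ := fun s =>
    h (walk lam v (fun i => if hi : i ∈ Finset.range n then s ⟨i, hi⟩ else false) n)
  have hm : Measurable fun ω => fun j : Finset.range n => ε j ω :=
    measurable_pi_lambda _ fun j => hε.measurable j
  refine Integrable.of_bound ((measurable_of_finite Ψ).comp hm).aestronglyMeasurable
    (∑ s, ‖Ψ s‖) (Eventually.of_forall fun ω => ?_)
  exact Finset.single_le_sum (f := fun s => ‖Ψ s‖) (fun s _ => norm_nonneg _)
    (Finset.mem_univ fun j : Finset.range n => ε j ω)

lemma indepFun_coin_walk (hε : IsCoinTossing μ p ε) (lam : ℝ) (v : ℝ × ℝ) (n : ℕ)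
    (φ : Bool → ℝ) (h : ℝ × ℝ → ℝ) :
    IndepFun (fun ω => φ (ε n ω)) (fun ω => h (walk lam v (fun i => ε i ω) n)) μ := by
  simp_rw [walk_eq_comp lam v ε n]
  have hI := hε.indep.indepFun_finset {n} (Finset.range n) (by simp) hε.measurable
  exact hI.comp (φ := fun s : ({n} : Finset ℕ) → Bool => φ (s ⟨n, Finset.mem_singleton_self n⟩))
    (ψ := fun s : Finset.range n → Bool =>
      h (walk lam v (fun i => if hi : i ∈ Finset.range n then s ⟨i, hi⟩ else false) n))
    (measurable_of_finite _) (measurable_of_finite _)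

lemma integral_coin (hε : IsCoinTossing μ p ε) (hp0 : 0 ≤ p) (n : ℕ) :
    ∫ ω, (if ε n ω = true then (1 : ℝ) else 0) ∂μ = p := by
  have hs : MeasurableSet {ω | ε n ω = true} := hε.measurable n (measurableSet_singleton true)
  have : (fun ω => if ε n ω = true then (1 : ℝ) else 0)
      = Set.indicator {ω | ε n ω = true} 1 := by
    ext ω
    simp [Set.indicator]
  rw [this, integral_indicator_one hs, Measure.real, hε.prob_true n, ENNReal.toReal_ofReal hp0]

lemma integral_comp_walk_succ [IsProbabilityMeasure μ]
    (hε : IsCoinTossing μ p ε) (hp0 : 0 ≤ p) (lam : ℝ) (v : ℝ × ℝ)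
    (n : ℕ) (h : ℝ × ℝ → ℝ) :
    ∫ ω, h (walk lam v (fun i => ε i ω) (n + 1)) ∂μ
      = p * ∫ ω, h (stepPlus lam (walk lam v (fun i => ε i ω) n)) ∂μ
        + (1 - p) * ∫ ω, h (stepMinus lam (walk lam v (fun i => ε i ω) n)) ∂μ := by
  set φ : Bool → ℝ := fun b => if b = true then 1 else 0 with hφ
  have e : ∀ ω, h (walk lam v (fun i => ε i ω) (n + 1))
      = φ (ε n ω) * h (stepPlus lam (walk lam v (fun i => ε i ω) n))
        + (1 - φ (ε n ω)) * h (stepMinus lam (walk lam v (fun i => ε i ω) n)) := by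
    intro ω
    rw [walk]
    by_cases hb : ε n ω = true <;> simp [hφ, hb]
  have hφi : Integrable (fun ω => φ (ε n ω)) μ :=
    Integrable.of_bound ((measurable_of_finite φ).comp (hε.measurable n)).aestronglyMeasurable 1
      (Eventually.of_forall fun ω => by by_cases hb : ε n ω = true <;> simp [hφ, hb])
  have hφ1 : Integrable (fun ω => 1 - φ (ε n ω)) μ := (integrable_const 1).sub hφi
  have i1 := indepFun_coin_walk hε lam v n φ (fun z => h (stepPlus lam z))
  have i2 := indepFun_coin_walk hε lam v n (fun b => 1 - φ b) (fun z => h (stepMinus lam z))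
  have j1 := integrable_comp_walk hε lam v n (fun z => h (stepPlus lam z))
  have j2 := integrable_comp_walk hε lam v n (fun z => h (stepMinus lam z))
  have k1 := i1.integral_fun_mul_eq_mul_integral hφi.aestronglyMeasurable j1.aestronglyMeasurable
  have k2 := i2.integral_fun_mul_eq_mul_integral hφ1.aestronglyMeasurable j2.aestronglyMeasurable
  have hint : ∫ ω, φ (ε n ω) ∂μ = p := integral_coin hε hp0 n
  rw [integral_sub (integrable_const 1) hφi, hint, integral_const, probReal_univ, one_smul] at k2
  rw [hint] at k1
  simp_rw [e]
  rw [← k1, ← k2]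
  exact integral_add (i1.integrable_mul hφi j1) (i2.integrable_mul hφ1 j2)

lemma integral_meanFun_walk [IsProbabilityMeasure μ]
    (hε : IsCoinTossing μ p ε) (hp0 : 0 ≤ p) (lam : ℝ) (v : ℝ × ℝ)
    (n j : ℕ) :
    ∫ ω, meanFun lam p j (walk lam v (fun i => ε i ω) n) ∂μ = meanFun lam p (n + j) v := by
  induction n generalizing j with
  | zero => simp [walk]
  | succ n ih =>
    rw [integral_comp_walk_succ hε hp0, show n + 1 + j = n + (j + 1) by ring, ← ih (j + 1)]
    simp only [meanFun]
    rw [integral_add ((integrable_comp_walk hε lam v n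
        (fun z => meanFun lam p j (stepPlus lam z))).const_mul p)
      ((integrable_comp_walk hε lam v n
        (fun z => meanFun lam p j (stepMinus lam z))).const_mul (1 - p)),
      integral_const_mul, integral_const_mul]

/-- A random Fibonacci sequence has integrable terms, and their means are given by `meanFun`. -/
theorem IsRandomFibonacci.integrable_and_integral [IsProbabilityMeasure μ] {lam : ℝ} (hp0 : 0 ≤ p)
    {g : ℕ → Ω → ℝ} (hg : IsRandomFibonacci μ p lam g) :
    ∃ v : ℝ × ℝ, 0 < v.1 ∧ 0 < v.2 ∧
      ∀ n, Integrable (g (n + 1)) μ ∧ ∫ ω, g (n + 1) ω ∂μ = meanFun lam p n v := by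
  obtain ⟨⟨a, ha, hga⟩, ⟨b, hb, hgb⟩, ε, hε, hstep⟩ := hg
  have hε' : IsCoinTossing μ p fun n => ε (n + 1) :=
    ⟨fun n => hε.measurable _, hε.indep.precomp (add_left_injective 1),
      fun n => hε.prob_true _⟩
  have hwalk : ∀ n ω, walk lam (a, b) (fun i => ε (i + 1) ω) n = (g (n + 1) ω, g (n + 2) ω) := by
    intro n ω
    induction n with
    | zero => simp [walk, hga, hgb]
    | succ n ih =>
      rw [walk, ih, hstep (n + 1) (by omega) ω]
      by_cases hb : ε (n + 1) ω = true <;> simp [hb, stepPlus, stepMinus]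
  refine ⟨(a, b), ha, hb, fun n => ?_⟩
  have e : g (n + 1) = fun ω => Prod.fst (walk lam (a, b) (fun i => ε (i + 1) ω) n) := by
    funext ω
    rw [hwalk]
  constructor
  · rw [e]
    exact integrable_comp_walk hε' lam (a, b) n Prod.fst
  · have := integral_meanFun_walk hε' hp0 lam (a, b) n 0
    rw [add_zero] at this
    rw [← this, e]
    rfl

end Probability

/-! ### The root of the polynomial in the supercritical case -/

section Root

variable {k : ℕ} {p : ℝ}

/-- Bernoulli's inequality in the form `(k - 1) p q ^ (k - 1) ≤ 1`. -/
lemma pred_mul_excursionWeight_le (hk : 3 ≤ k) (hp0 : 0 ≤ p) (hp1 : p ≤ 1) :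
    (k - 1) * (p * (1 - p) ^ (k - 1)) ≤ 1 := by
  obtain ⟨n, rfl⟩ : ∃ n, k = n + 1 := ⟨k - 1, by omega⟩
  have hq : 0 ≤ 1 - p := sub_nonneg.2 hp1
  have h1 := one_add_mul_le_pow (a := p) (by linarith) n
  have h2 : (1 + p) ^ n * (1 - p) ^ n ≤ 1 := by
    rw [← mul_pow]
    exact pow_le_one₀ (by positivity) (by nlinarith)
  have h3 := mul_le_mul_of_nonneg_right h1 (pow_nonneg hq n)
  have h4 := pow_nonneg hq n
  push_cast
  rw [add_sub_cancel_right]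
  nlinarith

lemma two_sub_lambdaK_le (hk : 5 ≤ k) : 2 - lambdaK k ≤ 2 / k := by
  have hk' : (5 : ℝ) ≤ k := by exact_mod_cast hk
  have h := Real.one_sub_sq_div_two_le_cos (x := Real.pi / k)
  have hpi : Real.pi ^ 2 ≤ 10 := by nlinarith [Real.pi_pos, Real.pi_lt_d2]
  have h2 : (Real.pi / k) ^ 2 ≤ 2 / k := by
    rw [div_pow, div_le_div_iff₀ (by positivity) (by positivity)]
    nlinarith
  unfold lambdaK
  linarith

/-- A point beyond the root, inside the disc of convergence, and at which `t(x) ≤ 1`. It is `1 / q`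
for `p ≤ 1 / k`, and `1` for `2 p ≥ 2 - λ_k`; the two ranges cover everything except for small `k`,
where the remaining values of `p` are covered by explicit points. -/
lemma exists_deltaFun_neg (hk : 3 ≤ k) (hp : criticalP k < p) (hp1 : p ≤ 1) :
    ∃ x : ℝ, 0 < x ∧ (1 - p) * x ≤ 1 ∧ x ≤ 1 + p * (1 - p) ^ (k - 1) * x ^ k ∧
      (k - 1) * (p * (1 - p) ^ (k - 1) * x ^ k) ≤ 1 ∧ deltaFun k p x < 0 := by
  have hp0 : 0 < p := (criticalP_pos hk).trans hp
  have hk' : (3 : ℝ) ≤ k := by exact_mod_cast hk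
  have hl1 := one_le_lambdaK hk
  have hq0 : 0 ≤ 1 - p := sub_nonneg.2 hp1
  rcases le_or_gt (k * p) 1 with hkp | hkp
  · have hp1' : p < 1 := by nlinarith
    have hq : 0 < 1 - p := sub_pos.2 hp1'
    have e : p * (1 - p) ^ (k - 1) * ((1 - p)⁻¹) ^ k = p / (1 - p) := by
      obtain ⟨n, rfl⟩ : ∃ n, k = n + 1 := ⟨k - 1, by omega⟩
      rw [Nat.add_sub_cancel, inv_pow, pow_succ]
      field_simp
    refine ⟨(1 - p)⁻¹, by positivity, (mul_inv_cancel₀ hq.ne').le, ?_, ?_, ?_⟩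
    · rw [e]
      apply le_of_eq
      field_simp
      ring
    · rw [e, mul_div_assoc', div_le_one hq]
      linarith
    · rw [deltaFun_inv hk hp1']
      exact div_neg_of_neg_of_pos (by linarith) (by positivity)
  · rcases le_or_gt (2 - lambdaK k) (2 * p) with h2p | h2p
    · have hc := excursionWeight_nonneg hp0.le hp1 k
      refine ⟨1, one_pos, by linarith, by simpa using hc, ?_, ?_⟩
      · simpa using pred_mul_excursionWeight_le hk hp0.le hp1
      · simp only [deltaFun, one_pow, mul_one]
        set c := p * (1 - p) ^ (k - 1) with hcdef
        rcases hp1.eq_or_lt with rfl | hlt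
        · nlinarith
        · have : 0 < c := mul_pos hp0 (pow_pos (sub_pos.2 hlt) _)
          nlinarith
    · have hk5 : k < 5 := by
        by_contra! h5
        have h := two_sub_lambdaK_le h5
        have : 2 / (k : ℝ) < 2 * p := by
          rw [div_lt_iff₀ (by positivity)]
          linarith
        linarith
      interval_cases k
      · have hl : lambdaK 3 = 1 := by
          rw [lambdaK]
          push_cast
          rw [Real.cos_pi_div_three]
          norm_num
        rw [hl] at h2p
        norm_num at hkp
        have b1 : 1 / 8 ≤ p * (1 - p) ^ 2 := by nlinarith [sq_nonneg (p - 1 / 2)]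
        have b2 : p * (1 - p) ^ 2 ≤ 4 / 27 := by nlinarith [sq_nonneg (p - 1 / 3)]
        refine ⟨6 / 5, by norm_num, by nlinarith, ?_, ?_, ?_⟩
        · norm_num
          nlinarith
        · norm_num
          nlinarith
        · simp only [deltaFun, hl]
          norm_num
          nlinarith
      · have hl : lambdaK 4 = √2 := by
          rw [lambdaK]
          push_cast
          rw [Real.cos_pi_div_four]
          ring
        have hs1 : 1.414 ≤ √2 := Real.le_sqrt_of_sq_le (by norm_num)
        rw [hl] at h2p
        norm_num at hkp
        have hp3 : p ≤ 0.293 := by linarith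
        have hp4 : 0.25 ≤ p := by linarith
        have b0 : (0.707 : ℝ) ^ 3 ≤ (1 - p) ^ 3 := pow_le_pow_left₀ (by norm_num) (by linarith) 3
        have b0' : (1 - p) ^ 3 ≤ (0.75 : ℝ) ^ 3 := pow_le_pow_left₀ hq0 (by linarith) 3
        have b1 : 0.088 ≤ p * (1 - p) ^ 3 := by
          have := mul_le_mul hp4 b0 (by norm_num) hp0.le
          norm_num at this ⊢
          linarith
        have b2 : p * (1 - p) ^ 3 ≤ 0.124 := by
          have := mul_le_mul hp3 b0' (by positivity) (by norm_num)
          norm_num at this ⊢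
          linarith
        refine ⟨11 / 10, by norm_num, by linarith, ?_, ?_, ?_⟩
        · norm_num at b1 b2 ⊢
          nlinarith
        · norm_num at b1 b2 ⊢
          nlinarith
        · simp only [deltaFun, hl]
          norm_num at b1 b2 hs1 ⊢
          nlinarith

/-- The supercritical asymptotics, in terms of the inverse `x` of the root. -/
lemma exists_root_tendsto (hk : 3 ≤ k) (hp : criticalP k < p) (hp1 : p ≤ 1) {v : ℝ × ℝ}
    (h1 : 0 ≤ v.1) (h2 : 0 < v.2) :
    ∃ x t : ℝ, 0 < x ∧ (kernelPoly k p).eval x = 1 ∧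
      t = x / (1 + p * (1 - p) ^ (k - 1) * x ^ k) ∧ 0 < t ∧ t < 1 ∧
      ∃ L, 0 < L ∧ Tendsto (fun n => meanFun (lambdaK k) p n v * t ^ n) atTop (𝓝 L) := by
  have hp0 : 0 < p := (criticalP_pos hk).trans hp
  have hk0 : 0 < k := by omega
  have hk' : (3 : ℝ) ≤ k := by exact_mod_cast hk
  have hc := excursionWeight_nonneg hp0.le hp1 k
  obtain ⟨y, hy0, hqy, hty, hcy, hΔ⟩ := exists_deltaFun_neg hk hp hp1
  have hKy := (one_lt_eval_kernelPoly_iff hk).2 hΔ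
  obtain ⟨x, hx, hKx⟩ := intermediate_value_Ioo hy0.le
    (kernelPoly k p).continuous.continuousOn
    (show (1 : ℝ) ∈ Set.Ioo ((kernelPoly k p).eval 0) ((kernelPoly k p).eval y) from
      ⟨by rw [eval_kernelPoly_zero]; exact one_pos, hKy⟩)
  set c := p * (1 - p) ^ (k - 1) with hcdef
  have hx0 : 0 < x := hx.1
  have hsx : 0 < 1 + c * x ^ k := by positivity
  have hsy : 0 < 1 + c * y ^ k := by positivity
  have hcx : (k - 1) * (c * x ^ k) ≤ 1 := by
    refine le_trans ?_ hcy
    have := hx.2.le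
    have : (0 : ℝ) ≤ k - 1 := by linarith
    gcongr
  have htt := div_one_add_lt hk0 hc hx0.le hx.2 hcy
  have ht : x / (1 + c * x ^ k) * (1 + c * x ^ k) = x := div_mul_cancel₀ _ hsx.ne'
  have hw : (1 - p) * x < 1 := by
    rcases hp1.eq_or_lt with rfl | hlt
    · simp
    · exact (mul_lt_mul_of_pos_left hx.2 (sub_pos.2 hlt)).trans_le hqy
  refine ⟨x, _, hx0, hKx, rfl, by positivity, htt.trans_le ((div_le_one hsy).2 hty), ?_⟩
  exact meanFun_tendsto hk hp0 hp1 (by positivity) htt hsx (absHasSum_treeSeries hk0 hc hx0 hcx)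
    (absHasSum_treeSeries hk0 hc hy0 hcy) (by rw [ht]; exact hKx) (by rw [ht]; exact hw) h1 h2

end Root

theorem theorem1 (k : ℕ) (hk : 3 ≤ k) (p : ℝ) (hp0 : 0 ≤ p) (hp1 : p ≤ 1)
    {Ω : Type*} [MeasurableSpace Ω] (μ : Measure Ω) [IsProbabilityMeasure μ]
    (g : ℕ → Ω → ℝ) (hg : IsRandomFibonacci μ p (lambdaK k) g)
    (m : ℕ → ℝ) (hm : ∀ n, m n = ∫ ω, g n ω ∂μ) :
    (∀ n, 1 ≤ n → Integrable (g n) μ) ∧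
    (criticalP k < p →
      (∀ n, 1 ≤ n → 0 < m n) ∧
      ∃ α : ℝ, (0 < α ∧ (polyP k p).IsRoot α ∧
          ∀ x : ℝ, 0 < x → (polyP k p).IsRoot x → x = α) ∧
        Tendsto (fun n => m (n + 1) / m n) atTop
          (𝓝 (α * (1 + p * (1 - p) ^ (k - 1) / α ^ k))) ∧
        1 < α * (1 + p * (1 - p) ^ (k - 1) / α ^ k)) ∧
    (p = criticalP k → ∃ K : ℝ, ∀ n : ℕ, 1 ≤ n → |m n| ≤ K * n) ∧
    (p < criticalP k → ∃ K : ℝ, ∀ n : ℕ, 1 ≤ n → |m n| ≤ K) := by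
  obtain ⟨v, hv1, hv2, hgv⟩ := hg.integrable_and_integral hp0
  have hmv : ∀ n, m (n + 1) = meanFun (lambdaK k) p n v := fun n => by rw [hm, (hgv n).2]
  refine ⟨fun n hn => ?_, fun hp => ⟨fun n hn => ?_, ?_⟩, fun hp => ?_, fun hp => ?_⟩
  · obtain ⟨n, rfl⟩ : ∃ j, n = j + 1 := ⟨n - 1, by omega⟩
    exact (hgv n).1
  · obtain ⟨n, rfl⟩ : ∃ j, n = j + 1 := ⟨n - 1, by omega⟩
    rw [hmv]
    exact meanFun_pos (zero_le_one.trans (one_le_lambdaK hk)) ((criticalP_pos hk).trans hp) hp1 n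
      hv1 hv2
  · have hp0' : 0 < p := (criticalP_pos hk).trans hp
    obtain ⟨x, t, hx, hKx, ht, ht0, ht1, L, hL, hlim⟩ := exists_root_tendsto hk hp hp1 hv1.le hv2
    have hα : x⁻¹ * (1 + p * (1 - p) ^ (k - 1) / x⁻¹ ^ k) = t⁻¹ := by
      rw [ht, inv_div, inv_pow, div_inv_eq_mul, div_eq_inv_mul]
    refine ⟨x⁻¹, ⟨inv_pos.2 hx, ?_, fun y hy hroot => ?_⟩, ?_, ?_⟩
    · rw [isRoot_polyP_iff hk (inv_pos.2 hx), inv_inv, hKx]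
    · rw [isRoot_polyP_iff hk hy, ← hKx] at hroot
      rw [← (kernelPoly_strictMonoOn hk hp0' hp1).injOn (inv_nonneg.2 hy.le) hx.le hroot, inv_inv]
    · rw [hα, ← tendsto_add_atTop_iff_nat 1]
      have h2 := ((hlim.comp (tendsto_add_atTop_nat 1)).div hlim hL.ne').mul_const t⁻¹
      rw [div_self hL.ne', one_mul] at h2
      refine h2.congr fun n => ?_
      simp only [Function.comp, Pi.div_apply, hmv]
      rw [pow_succ]
      field_simp
    · rw [hα]
      exact (one_lt_inv₀ ht0).2 ht1
  · obtain ⟨M, hM⟩ := meanFun_linear_bound hk hp0 hp.le hv1.le hv2.le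
    refine ⟨M, fun n hn => ?_⟩
    obtain ⟨n, rfl⟩ : ∃ j, n = j + 1 := ⟨n - 1, by omega⟩
    rw [hmv]
    exact_mod_cast hM n
  · obtain ⟨M, hM⟩ := meanFun_bounded hk hp0 hp hv1.le hv2.le
    refine ⟨M, fun n hn => ?_⟩
    obtain ⟨n, rfl⟩ : ∃ j, n = j + 1 := ⟨n - 1, by omega⟩
    rw [hmv]
    exact hM n
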